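/- Let $W$ be one of the following germs at $(0,0)$ of singular $3$-webs in $(\mathbb C^2,0)$, given by the integral curves of an implicit cubic ODE with $p=dy/dx$: 5) $\;p^3+xy^2p+\dfrac{2}{\sqrt{27}}\,\dfrac{x^{3/2}y^3}{\tan\left(\frac{4}{\sqrt3}x^{3/2}\right)}=0$ (the coefficient extended holomorphically to $x=0$), or 6) $\;p^3+y^2p=\dfrac{2}{\sqrt{27}}\,y^3\tan\left(2\sqrt3\,x+L\right)$, where $L\in\mathbb C$ is any constant with $\cos L\neq 0$. Then there are a non-empty connected open set $T\subset\mathbb C$ and a family $(M_\tau)_{\tau\in T}$ of massive Frobenius $3$-fold germs, depending holomorphically on $\tau$, such that (i) the unity field $e$ of every $M_\tau$ satisfies $\langle e,e\rangle=0$; (ii) for every $\tau\in T$ and every surface germ through the base point of $M_\tau$ that is transverse to $e$, the booklet $3$-web germ of $M_\tau$ on this surface is diffeomorphic (by a local biholomorphism preserving the base points) to $W$; (iii) $M_\tau$ and $M_\sigma$ are not equivalent whenever $\tau\neq\sigma$ in $T$. Here a Frobenius $3$-fold germ is a germ of a complex $3$-manifold with a commutative, associative holomorphic multiplication on the tangent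 spaces, a flat non-degenerate holomorphic symmetric inner product with $\langle u\cdot v,w\rangle=\langle u,v\cdot w\rangle$, a unity field $e$ with $\nabla e=0$ and an Euler field $E$ with $\nabla\nabla E=0$, where $\nabla$ is the Levi-Civita connection, such that the flow of $E$ rescales the multiplication and the inner product ($\mathcal L_E(\cdot)=k\,(\cdot)$ with a constant $k\ne0$, and $\mathcal L_E\langle\,,\rangle=D\langle\,,\rangle$ with a constant $D$) and $(\nabla_z c)(u,v,w)$, $c(u,v,w)=\langle u\cdot v,w\rangle$, is symmetric in $u,v,w,z$. It is massive if the tangent algebra is semisimple at points arbitrarily close to the base point, i.e. has a basis of idempotents $e_1,e_2,e_3$ with $e_i\cdot e_j=\delta_{ij}e_i$. The booklet web on a surface transverse to $e$ consists of the three direction fields cut on the surface by the planes spanned by $e$ and $e_i$; at the non-semisimple points the directions, with multiplicity, are the zeros of the holomorphic binary cubic form that extends them. Two germs $M,\tilde M$ are equivalent if there is a local biholomorphism $\varphi$ between them, preserving the base points, with $\varphi^*\tilde g=c^2g$ for a nonzero constant $c$ and with $d\varphi$ an isomorphism of tangent algebras. -/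

import Mathlib

open Filter Topology

namespace FrobWeb

noncomputable section

/-- Coordinates on a germ of a complex threefold; the base point is the origin. -/
abbrev C3 : Type := Fin 3 → ℂ

/-- Coordinates on a germ of a complex surface; the base point is the origin. -/
abbrev C2 : Type := Fin 2 → ℂ

/-- The partial derivative with respect to the `i`-th coordinate of the threefold. -/
def pd (i : Fin 3) (f : C3 → ℂ) (p : C3) : ℂ := fderiv ℂ f p (Pi.single i 1)

/-- The Christoffel symbols `Γ^k_{ij}` of the Levi-Civita connection of the metric `g`. -/
def christoffel (g : C3 → Matrix (Fin 3) (Fin 3) ℂ) (i j k : Fin 3) (p : C3) : ℂ :=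
  (1 / 2) * ∑ l, (g p)⁻¹ k l *
    (pd i (fun q => g q j l) p + pd j (fun q => g q i l) p - pd l (fun q => g q i j) p)

/-- The curvature components `R^k_{lij}` of the Levi-Civita connection of `g`. -/
def curvature (g : C3 → Matrix (Fin 3) (Fin 3) ℂ) (i j l k : Fin 3) (p : C3) : ℂ :=
  pd i (christoffel g j l k) p - pd j (christoffel g i l k) p
    + ∑ m, (christoffel g i m k p * christoffel g j l m p
        - christoffel g j m k p * christoffel g i l m p)

/-- The components `(∇_i V)^k` of the covariant derivative of a vector field. -/
def covVec (g : C3 → Matrix (Fin 3) (Fin 3) ℂ) (V : C3 → C3) (i k : Fin 3) (p : C3) : ℂ :=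
  pd i (fun q => V q k) p + ∑ j, christoffel g i j k p * V p j

/-- The components `(∇_l ∇ V)_i^k` of the second covariant derivative of a vector field. -/
def covCovVec (g : C3 → Matrix (Fin 3) (Fin 3) ℂ) (V : C3 → C3) (l i k : Fin 3) (p : C3) : ℂ :=
  pd l (covVec g V i k) p
    + ∑ m, (christoffel g l m k p * covVec g V i m p - christoffel g l i m p * covVec g V m k p)

/-- The components `c_{ijk} = ⟨∂_i · ∂_j, ∂_k⟩`, where `∂_i · ∂_j = ∑ l, mul p i j l • ∂_l`. -/
def lowerMul (g : C3 → Matrix (Fin 3) (Fin 3) ℂ) (mul : C3 → Fin 3 → Fin 3 → Fin 3 → ℂ)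
    (i j k : Fin 3) (p : C3) : ℂ :=
  ∑ l, mul p i j l * g p l k

/-- The components `(∇_l c)_{ijk}` of the covariant derivative of the tensor `c`. -/
def covMul (g : C3 → Matrix (Fin 3) (Fin 3) ℂ) (mul : C3 → Fin 3 → Fin 3 → Fin 3 → ℂ)
    (l i j k : Fin 3) (p : C3) : ℂ :=
  pd l (lowerMul g mul i j k) p
    - ∑ m, (christoffel g l i m p * lowerMul g mul m j k p
        + christoffel g l j m p * lowerMul g mul i m k p
        + christoffel g l k m p * lowerMul g mul i j m p)

/-- The components of the Lie derivative of the metric along `V`. -/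
def lieMetric (V : C3 → C3) (g : C3 → Matrix (Fin 3) (Fin 3) ℂ) (i j : Fin 3) (p : C3) : ℂ :=
  ∑ l, (V p l * pd l (fun q => g q i j) p
    + g p l j * pd i (fun q => V q l) p + g p i l * pd j (fun q => V q l) p)

/-- The components of the Lie derivative of the multiplication tensor along `V`. -/
def lieMul (V : C3 → C3) (mul : C3 → Fin 3 → Fin 3 → Fin 3 → ℂ) (i j k : Fin 3) (p : C3) : ℂ :=
  ∑ l, (V p l * pd l (fun q => mul q i j k) p - mul p i j l * pd l (fun q => V q k) p
    + mul p l j k * pd i (fun q => V q l) p + mul p i l k * pd j (fun q => V q l) p)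

/-- The product of two tangent vectors at a point, given by structure constants. -/
def tangentMul (m : Fin 3 → Fin 3 → Fin 3 → ℂ) (u v : C3) : C3 :=
  fun k => ∑ i, ∑ j, u i * v j * m i j k

/-- The value of a bilinear form, given by its matrix, on two tangent vectors. -/
def pairing (g : Matrix (Fin 3) (Fin 3) ℂ) (u v : C3) : ℂ :=
  ∑ i, ∑ j, u i * g i j * v j

/-- A germ of a Frobenius threefold, written in arbitrary holomorphic coordinates centred at
its base point.  The tensors are represented by functions of which only the germ at the origin
matters; all identities hold on a neighbourhood of the origin. -/
structure FrobeniusGerm where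
  metric : C3 → Matrix (Fin 3) (Fin 3) ℂ
  mul : C3 → Fin 3 → Fin 3 → Fin 3 → ℂ
  unit : C3 → C3
  euler : C3 → C3
  /-- the weight with which the flow of the Euler field scales the inner product -/
  metricWeight : ℂ
  /-- the weight with which the flow of the Euler field scales the multiplication -/
  mulWeight : ℂ
  metric_analytic : ∀ i j, AnalyticAt ℂ (fun p => metric p i j) 0
  mul_analytic : ∀ i j k, AnalyticAt ℂ (fun p => mul p i j k) 0
  unit_analytic : ∀ i, AnalyticAt ℂ (fun p => unit p i) 0
  euler_analytic : ∀ i, AnalyticAt ℂ (fun p => euler p i) 0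
  mul_comm : ∀ᶠ p in 𝓝 (0 : C3), ∀ u v, tangentMul (mul p) u v = tangentMul (mul p) v u
  mul_assoc : ∀ᶠ p in 𝓝 (0 : C3), ∀ u v w,
    tangentMul (mul p) (tangentMul (mul p) u v) w = tangentMul (mul p) u (tangentMul (mul p) v w)
  metric_symm : ∀ᶠ p in 𝓝 (0 : C3), (metric p).IsSymm
  metric_nondegenerate : ∀ᶠ p in 𝓝 (0 : C3), (metric p).det ≠ 0
  metric_invariant : ∀ᶠ p in 𝓝 (0 : C3), ∀ u v w,
    pairing (metric p) (tangentMul (mul p) u v) w = pairing (metric p) u (tangentMul (mul p) v w)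
  metric_flat : ∀ᶠ p in 𝓝 (0 : C3), ∀ i j l k, curvature metric i j l k p = 0
  unit_mul : ∀ᶠ p in 𝓝 (0 : C3), ∀ v, tangentMul (mul p) (unit p) v = v
  unit_parallel : ∀ᶠ p in 𝓝 (0 : C3), ∀ i k, covVec metric unit i k p = 0
  euler_linear : ∀ᶠ p in 𝓝 (0 : C3), ∀ l i k, covCovVec metric euler l i k p = 0
  euler_metric : ∀ᶠ p in 𝓝 (0 : C3), ∀ i j,
    lieMetric euler metric i j p = metricWeight * metric p i j
  euler_mul : ∀ᶠ p in 𝓝 (0 : C3), ∀ i j k,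
    lieMul euler mul i j k p = mulWeight * mul p i j k
  /-- the rescaling is a genuine one; this excludes for instance the zero Euler field -/
  mulWeight_ne_zero : mulWeight ≠ 0
  potential : ∀ᶠ p in 𝓝 (0 : C3), ∀ l i j k,
    covMul metric mul l i j k p = covMul metric mul i l j k p ∧
    covMul metric mul l i j k p = covMul metric mul l j i k p ∧
    covMul metric mul l i j k p = covMul metric mul l i k j p

namespace FrobeniusGerm

/-- `ε` is a basis of the tangent space at `p` with `ε_i · ε_j = δ_{ij} ε_i`. -/
def IsIdempotentBasis (M : FrobeniusGerm) (p : C3) (ε : Fin 3 → C3) : Prop :=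
  LinearIndependent ℂ ε ∧ ∀ i j, tangentMul (M.mul p) (ε i) (ε j) = if i = j then ε i else 0

/-- The tangent algebra at `p` is semisimple. -/
def IsSemisimpleAt (M : FrobeniusGerm) (p : C3) : Prop := ∃ ε, M.IsIdempotentBasis p ε

/-- The tangent algebra is semisimple at points arbitrarily close to the base point. -/
def IsMassive (M : FrobeniusGerm) : Prop := ∃ᶠ p in 𝓝 (0 : C3), M.IsSemisimpleAt p

/-- The unity field satisfies `⟨e, e⟩ = 0`. -/
def HasNullUnit (M : FrobeniusGerm) : Prop :=
  ∀ᶠ p in 𝓝 (0 : C3), pairing (M.metric p) (M.unit p) (M.unit p) = 0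

/-- Equivalence of germs: a local biholomorphism preserving the base points which multiplies
the metric by a nonzero constant and is an isomorphism on tangent algebras. -/
def Equivalent (M N : FrobeniusGerm) : Prop :=
  ∃ φ : C3 → C3, AnalyticAt ℂ φ 0 ∧ φ 0 = 0 ∧ Function.Bijective (fderiv ℂ φ 0) ∧
    ∃ c : ℂ, c ≠ 0 ∧ ∀ᶠ p in 𝓝 (0 : C3), ∀ u v,
      pairing (N.metric (φ p)) (fderiv ℂ φ p u) (fderiv ℂ φ p v)
        = c ^ 2 * pairing (M.metric p) u v ∧
      fderiv ℂ φ p (tangentMul (M.mul p) u v)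
        = tangentMul (N.mul (φ p)) (fderiv ℂ φ p u) (fderiv ℂ φ p v)

/-- All structure tensors depend holomorphically on the point and on the parameter `τ ∈ T`. -/
def IsHolomorphicFamily (T : Set ℂ) (F : ℂ → FrobeniusGerm) : Prop :=
  ∀ τ ∈ T,
    (∀ i j, AnalyticAt ℂ (fun q : ℂ × C3 => (F q.1).metric q.2 i j) (τ, 0)) ∧
    (∀ i j k, AnalyticAt ℂ (fun q : ℂ × C3 => (F q.1).mul q.2 i j k) (τ, 0)) ∧
    (∀ i, AnalyticAt ℂ (fun q : ℂ × C3 => (F q.1).unit q.2 i) (τ, 0)) ∧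
    (∀ i, AnalyticAt ℂ (fun q : ℂ × C3 => (F q.1).euler q.2 i) (τ, 0))

end FrobeniusGerm

/-- The coefficients of a binary differential form `∑ i, K i * dy ^ i * dx ^ (3 - i)`. -/
abbrev CubicForm : Type := Fin 4 → C2 → ℂ

/-- The value of the cubic form at the point `q` on the tangent vector `v = (dx, dy)`. -/
def CubicForm.eval (K : CubicForm) (q v : C2) : ℂ :=
  ∑ i : Fin 4, K i q * v 1 ^ (i : ℕ) * v 0 ^ (3 - (i : ℕ))

/-- Holomorphic coefficients that do not vanish simultaneously at the base point. -/
def IsWebGerm (K : CubicForm) : Prop :=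
  (∀ i, AnalyticAt ℂ (K i) 0) ∧ ∃ i, K i 0 ≠ 0

/-- The web germs of zero directions of `K` and `K'` are diffeomorphic: some local
biholomorphism pulls `K'` back to `K` up to a nonvanishing holomorphic factor. -/
def WebDiffeomorphic (K K' : CubicForm) : Prop :=
  ∃ Φ : C2 → C2, AnalyticAt ℂ Φ 0 ∧ Φ 0 = 0 ∧ Function.Bijective (fderiv ℂ Φ 0) ∧
    ∃ κ : C2 → ℂ, AnalyticAt ℂ κ 0 ∧ κ 0 ≠ 0 ∧
      ∀ᶠ q in 𝓝 (0 : C2), ∀ v, K'.eval (Φ q) (fderiv ℂ Φ q v) = κ q * K.eval q v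

/-- `ψ` parametrizes a surface germ through the base point, transverse to the unity field. -/
def IsTransverseSurface (M : FrobeniusGerm) (ψ : C2 → C3) : Prop :=
  AnalyticAt ℂ ψ 0 ∧ ψ 0 = 0 ∧ Function.Injective (fderiv ℂ ψ 0) ∧
    ∀ v, fderiv ℂ ψ 0 v ≠ M.unit 0

/-- `K` defines the booklet web of `M` on the surface `ψ`, in the parameters of `ψ`: at the
points with semisimple tangent algebra, which are dense, the zero directions of `K` are those
cut on the surface by the planes spanned by `e` and one of the idempotents `e_i`. By continuity
this determines the directions, with multiplicity, at the other points. -/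
def IsBookletWeb (M : FrobeniusGerm) (ψ : C2 → C3) (K : CubicForm) : Prop :=
  IsWebGerm K ∧
  ∀ᶠ q in 𝓝 (0 : C2),
    q ∈ closure {q' | M.IsSemisimpleAt (ψ q')} ∧
    ∀ ε, M.IsIdempotentBasis (ψ q) ε → ∀ v,
      K.eval q v = 0 ↔ ∃ i, fderiv ℂ ψ q v ∈ Submodule.span ℂ {M.unit (ψ q), ε i}

/-- The cubic form of the ODE `p ^ 3 + S * p ^ 2 + A * p + B = 0`, with `p = dy / dx`. -/
def monicCubic (S A B : C2 → ℂ) : CubicForm := ![B, A, S, fun _ => 1]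

/-- The function `x ^ (3/2) / tan (4 / √3 * x ^ (3/2))`. It does not depend on the branch of
`x ^ (3/2)` and extends holomorphically to `x = 0` with the value `√3 / 4`. -/
def cotCoeff (x : ℂ) : ℂ :=
  if x = 0 then (Real.sqrt 3 : ℂ) / 4
  else x ^ (3 / 2 : ℂ) / Complex.tan (4 / (Real.sqrt 3 : ℂ) * x ^ (3 / 2 : ℂ))

/-- `p^3 + x y^2 p + (2/√27) x^(3/2) y^3 / tan ((4/√3) x^(3/2)) = 0`. -/
def webForm5 : CubicForm :=
  monicCubic (fun _ => 0) (fun q => q 0 * q 1 ^ 2)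
    (fun q => 2 / (Real.sqrt 27 : ℂ) * q 1 ^ 3 * cotCoeff (q 0))

/-- `p^3 + y^2 p = (2/√27) y^3 tan (2 √3 x + L)`. -/
def webForm6 (L : ℂ) : CubicForm :=
  monicCubic (fun _ => 0) (fun q => q 1 ^ 2)
    (fun q => -(2 / (Real.sqrt 27 : ℂ) * q 1 ^ 3 *
      Complex.tan (2 * (Real.sqrt 3 : ℂ) * q 0 + L)))

end

end FrobWeb

namespace FrobWeb

/-! The germs are built in flat coordinates `(x, y, z)` with the antidiagonal metric, `e = ∂_x`, `E
= 2x∂_x + y∂_y` and the potential `x²z/2 + xy²/2 + y⁴h(z)`. Associativity is then Chazy's equation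
`h''' = 144h'² - 96hh''`. The idempotents cut out on every transverse surface the form `dy³ - 24hy
dy²dz - 24h'y² dy dz² - 4h''y³ dz³`, which does not involve `x`. Completing the cube with `dy - 8hy
dz` leaves two coefficients `A`, `B`, and Chazy's equation becomes a first order system for `(h, A,
B)`.

The given webs have the shape `p³ + αy²p + βy³ = 0` with `α`, `β` functions of `x`. Such a web is
matched by `x = S(z)`, `y ↦ n(z)y` as soon as `A = α(S)S'²`, `B = β(S)S'³`, `n' = -8hn`. Inserted
into the system, this asks for a holomorphic `G` with `α' = 6β - Gα` and `β' = -(3/2)Gβ - (4/3)α²`,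
and for a third order equation on `S` that the substitution `S' = p(S)²` makes linear
(`exists_isWebPotential`). For web 6, `α = 1` forces `G = 6β` and `β` solves a Riccati equation; for
web 5, `α = x` forces `xG = 6β - 1`, which is solvable because `β(0) = 1/6`.

The parameter comes from the Möbius maps `z/(1 + tz)`: they preserve the web, `A(0)` and `B(0)`, and
add `t/8` to `h(0)` (`IsWebPotential.moebius`). An equivalence is a homothety of a flat metric,
hence linear, and the algebra forces it to be `diag(1, s, s²)`; so `h(0)`, `A(0)`, `B(0)` scale by
`s²`, `s⁴`, `s⁶` (`exists_scaling_of_equivalent`). The discriminant `4A³ + 27B²` is nonzero at the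
origin, so `A(0)` and `B(0)` are not both zero and `s²` is a square root or a cube root of unity.
Hence `h(0)` separates the germs when it stays in a small disc around `1`. -/

/-! ### Analytic functions with prescribed Taylor coefficients, and linear equations -/

/-- A power series with geometrically bounded coefficients. -/
theorem exists_hasFPowerSeriesAt {e : ℕ → ℂ} {M R : ℝ} (hR : 0 < R)
    (he : ∀ n, ‖e n‖ ≤ M * R ^ n) :
    ∃ f : ℂ → ℂ, HasFPowerSeriesAt f (FormalMultilinearSeries.ofScalars ℂ e) 0 := by
  have hrad : 0 < (FormalMultilinearSeries.ofScalars ℂ e).radius := by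
    have hr : 0 < (⟨R⁻¹, (inv_pos.2 hR).le⟩ : NNReal) := inv_pos.2 hR
    refine lt_of_lt_of_le (ENNReal.coe_pos.2 hr)
      (FormalMultilinearSeries.le_radius_of_bound _ M fun n => ?_)
    rw [FormalMultilinearSeries.ofScalars_norm]
    change ‖e n‖ * R⁻¹ ^ n ≤ M
    rw [inv_pow, ← div_eq_mul_inv, div_le_iff₀ (by positivity)]
    exact he n
  exact ⟨_, (FormalMultilinearSeries.hasFPowerSeriesOnBall _ hrad).hasFPowerSeriesAt⟩

theorem iteratedDeriv_eq_of_hasFPowerSeriesAt {e : ℕ → ℂ} {f : ℂ → ℂ}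
    (hf : HasFPowerSeriesAt f (FormalMultilinearSeries.ofScalars ℂ e) 0) (n : ℕ) :
    iteratedDeriv n f 0 = n.factorial * e n := by
  have h := hf.eq_formalMultilinearSeries hf.analyticAt.hasFPowerSeriesAt
  have h2 := congrArg (fun p => FormalMultilinearSeries.coeff p n) h
  simp only [FormalMultilinearSeries.coeff_ofScalars] at h2
  rw [h2]
  field_simp [Nat.cast_ne_zero.2 n.factorial_ne_zero]

theorem eventually_eq_of_iteratedDeriv {f g : ℂ → ℂ} (hf : AnalyticAt ℂ f 0)
    (hg : AnalyticAt ℂ g 0) (h : ∀ n, iteratedDeriv n f 0 = iteratedDeriv n g 0) :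
    ∀ᶠ z in 𝓝 (0 : ℂ), f z = g z := by
  have h1 := hf.hasFPowerSeriesAt.eventually_hasSum
  have h2 := hg.hasFPowerSeriesAt.eventually_hasSum
  simp only [← h, zero_add] at h2 h1
  filter_upwards [h1, h2] with z a b using a.unique b

/-- The Taylor coefficients of the solution of `f'' = Q f`, where `Q` has the coefficients `p`. -/
noncomputable def odeCoeff (p : ℕ → ℂ) (c₀ c₁ : ℂ) : ℕ → ℂ
  | 0 => c₀
  | 1 => c₁
  | n + 2 => (∑ i : Fin (n + 1), p i * odeCoeff p c₀ c₁ (n - i)) / ((n + 2) * (n + 1))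
decreasing_by omega

/-- Each of the `n + 1` summands is at most `M R ^ (n + 2)`, and the divisor `(n + 2)(n + 1)`
absorbs their number, so the bound propagates with the same `M`. -/
theorem norm_odeCoeff_le {p : ℕ → ℂ} {R M : ℝ} {c₀ c₁ : ℂ} (hR : 1 ≤ R)
    (hp : ∀ n, ‖p n‖ ≤ R ^ (n + 2)) (h₀ : ‖c₀‖ ≤ M) (h₁ : ‖c₁‖ ≤ M) (n : ℕ) :
    ‖odeCoeff p c₀ c₁ n‖ ≤ M * R ^ n := by
  have hM : 0 ≤ M := (norm_nonneg _).trans h₀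
  induction n using Nat.strong_induction_on with
  | _ n ih =>
    match n, ih with
    | 0, _ => simpa [odeCoeff] using h₀
    | 1, _ =>
      rw [odeCoeff, pow_one]
      nlinarith
    | n + 2, ih =>
      rw [odeCoeff, norm_div, div_le_iff₀ (by
        rw [norm_pos_iff]; exact mul_ne_zero (by norm_cast) (by norm_cast))]
      have hn : ‖((n : ℂ) + 2) * (n + 1)‖ = ((n : ℝ) + 2) * (n + 1) := by
        rw [norm_mul]; norm_cast
      rw [hn]
      calc ‖∑ i : Fin (n + 1), p i * odeCoeff p c₀ c₁ (n - i)‖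
          ≤ ∑ i : Fin (n + 1), M * R ^ (n + 2) := by
            refine norm_sum_le_of_le _ fun i _ => ?_
            have hi : (i : ℕ) ≤ n := Nat.lt_succ_iff.1 i.2
            have h1 := ih (n - i) (by omega)
            rw [norm_mul]
            calc ‖p i‖ * ‖odeCoeff p c₀ c₁ (n - i)‖ ≤ R ^ ((i : ℕ) + 2) * (M * R ^ (n - i)) :=
                  mul_le_mul (hp i) h1 (norm_nonneg _) (by positivity)
              _ = M * R ^ (n + 2) := by
                rw [show n + 2 = ((i : ℕ) + 2) + (n - i) by omega, pow_add R (i + 2)]; ring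
        _ = M * R ^ (n + 2) * (n + 1) := by
            rw [Finset.sum_const, Finset.card_univ, Fintype.card_fin, nsmul_eq_mul]
            push_cast; ring
        _ ≤ M * R ^ (n + 2) * ((n + 2) * (n + 1)) := by
            refine mul_le_mul_of_nonneg_left ?_ (by positivity)
            nlinarith [(Nat.cast_nonneg n : (0 : ℝ) ≤ n)]

/-- The initial value problem for `f'' = Q f` with holomorphic `Q`. -/
theorem exists_analyticAt_deriv_deriv_eq {Q : ℂ → ℂ} (hQ : AnalyticAt ℂ Q 0) (c₀ c₁ : ℂ) :
    ∃ f : ℂ → ℂ, AnalyticAt ℂ f 0 ∧ f 0 = c₀ ∧ deriv f 0 = c₁ ∧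
      ∀ᶠ z in 𝓝 (0 : ℂ), deriv (deriv f) z = Q z * f z := by
  set p : ℕ → ℂ := fun n => iteratedDeriv n Q 0 / n.factorial with hpdef
  obtain ⟨C, r, hC, hr, hCr⟩ := FormalMultilinearSeries.le_mul_pow_of_radius_pos _
    hQ.hasFPowerSeriesAt.radius_pos
  -- Taking `R` above `C` and `1` as well as `r` turns the bound `C r ^ n` into `R ^ (n + 2)`.
  set R : ℝ := max r (max C 1)
  have hRr : r ≤ R := le_max_left _ _
  have hRC : C ≤ R := (le_max_left _ _).trans (le_max_right _ _)
  have hR1 : 1 ≤ R := (le_max_right _ _).trans (le_max_right _ _)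
  have hp : ∀ n, ‖p n‖ ≤ R ^ (n + 2) := by
    intro n
    have h := hCr n
    rw [FormalMultilinearSeries.ofScalars_norm] at h
    have hn : r ^ n ≤ R ^ n := pow_le_pow_left₀ hr.le hRr n
    calc ‖p n‖ ≤ C * r ^ n := h
      _ ≤ R ^ 2 * R ^ n := mul_le_mul (by nlinarith) hn (by positivity) (by positivity)
      _ = R ^ (n + 2) := by ring
  have hb := norm_odeCoeff_le (M := max ‖c₀‖ ‖c₁‖) hR1 hp (le_max_left _ _) (le_max_right _ _)
  obtain ⟨f, hf⟩ := exists_hasFPowerSeriesAt (by positivity) hb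
  have hd := iteratedDeriv_eq_of_hasFPowerSeriesAt hf
  have hfa := hf.analyticAt
  refine ⟨f, hfa, ?_, ?_, ?_⟩
  · simpa [odeCoeff] using hd 0
  · simpa [odeCoeff, iteratedDeriv_one] using hd 1
  · refine eventually_eq_of_iteratedDeriv hfa.deriv.deriv (hQ.mul hfa) fun n => ?_
    rw [← iteratedDeriv_succ', ← iteratedDeriv_succ', hd, iteratedDeriv_fun_mul hQ.contDiffAt
      hfa.contDiffAt, odeCoeff, Finset.sum_range]
    have h2 : ((n : ℂ) + 2) * (n + 1) ≠ 0 := mul_ne_zero (by norm_cast) (by norm_cast)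
    have h3 : ((n + 1 + 1).factorial : ℂ) = ((n : ℂ) + 2) * (n + 1) * n.factorial := by
      rw [Nat.factorial_succ, Nat.factorial_succ]; push_cast; ring
    rw [h3, mul_assoc, mul_left_comm, mul_div_cancel₀ _ h2, Finset.mul_sum]
    refine Finset.sum_congr rfl fun i _ => ?_
    have hi : (i : ℕ) ≤ n := Nat.lt_succ_iff.1 i.2
    have h4 : ((n.choose i : ℕ) : ℂ) * (i : ℕ).factorial * (n - i).factorial = n.factorial := by
      exact_mod_cast Nat.choose_mul_factorial_mul_factorial hi
    rw [hd, ← h4, hpdef]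
    have h5 : ((i : ℕ).factorial : ℂ) ≠ 0 := Nat.cast_ne_zero.2 (Nat.factorial_ne_zero _)
    field_simp

/-- A local primitive of a holomorphic function. -/
theorem exists_primitive {f : ℂ → ℂ} (hf : AnalyticAt ℂ f 0) :
    ∃ g : ℂ → ℂ, AnalyticAt ℂ g 0 ∧ g 0 = 0 ∧ ∀ᶠ z in 𝓝 (0 : ℂ), HasDerivAt g (f z) z := by
  obtain ⟨r, hr, h⟩ := Metric.eventually_nhds_iff_ball.1 hf.eventually_analyticAt
  obtain ⟨g, hg⟩ := DifferentiableOn.isExactOn_ball (c := (0 : ℂ)) (r := r) (f := f)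
    fun z hz => (h z hz).differentiableAt.differentiableWithinAt
  have hg' : ∀ᶠ z in 𝓝 (0 : ℂ), HasDerivAt (fun z => g z - g 0) (f z) z := by
    filter_upwards [Metric.ball_mem_nhds 0 hr] with z hz using (hg z hz).sub_const _
  exact ⟨_, Complex.analyticAt_iff_eventually_differentiableAt.2
    (hg'.mono fun z hz => hz.differentiableAt), sub_self _, hg'⟩

/-- A holomorphic local inverse. -/
theorem exists_local_inverse {f f' : ℂ → ℂ} (hf : AnalyticAt ℂ f 0) (h0 : f 0 = 0)
    (hd : ∀ᶠ z in 𝓝 (0 : ℂ), HasDerivAt f (f' z) z) (hne : ∀ᶠ z in 𝓝 (0 : ℂ), f' z ≠ 0) :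
    ∃ s : ℂ → ℂ, AnalyticAt ℂ s 0 ∧ s 0 = 0 ∧
      ∀ᶠ z in 𝓝 (0 : ℂ), HasDerivAt s (f' (s z))⁻¹ z := by
  have hd0 : deriv f 0 ≠ 0 := by rw [hd.self_of_nhds.deriv]; exact hne.self_of_nhds
  have hs := hf.analyticAt_localInverse hd0
  have hs0 : hf.hasStrictDerivAt.localInverse _ _ _ hd0 (f 0) = 0 :=
    HasStrictFDerivAt.localInverse_apply_image ..
  have hr := hf.hasStrictDerivAt.eventually_right_inverse hd0
  set s := hf.hasStrictDerivAt.localInverse _ _ _ hd0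
  rw [h0] at hs hs0 hr
  refine ⟨s, hs, hs0, ?_⟩
  have hc : Tendsto s (𝓝 0) (𝓝 0) := by simpa [ContinuousAt, hs0] using hs.continuousAt
  filter_upwards [hs.eventually_analyticAt, hc.eventually hd, hc.eventually hne,
    hr.eventually_nhds] with z h1 h2 h3 h4
  have h5 := (h2.comp z h1.differentiableAt.hasDerivAt).congr_of_eventuallyEq
    (f₁ := fun z => z) (h4.mono fun w hw => hw.symm)
  have h6 := h5.unique (hasDerivAt_id' z)
  have h7 := h1.differentiableAt.hasDerivAt
  rwa [eq_inv_of_mul_eq_one_right h6] at h7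

/-! ### Solutions of the Chazy system adapted to a web -/

/-- A local solution `(h, A, B)` of the first order form of the Chazy equation, together with
a change of coordinates `(z, y) ↦ (S z, n z * y)` that takes the cubic form
`(dy - 8 h y dz)^3 + A y^2 (dy - 8 h y dz) dz^2 + B y^3 dz^3` to a multiple of
`dy^3 + α y^2 dy dx^2 + β y^3 dx^3`. -/
structure IsWebPotential (α β h A B S n : ℂ → ℂ) : Prop where
  h_analytic : AnalyticAt ℂ h 0
  A_analytic : AnalyticAt ℂ A 0
  B_analytic : AnalyticAt ℂ B 0
  S_analytic : AnalyticAt ℂ S 0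
  n_analytic : AnalyticAt ℂ n 0
  S_zero : S 0 = 0
  S_deriv_ne : deriv S 0 ≠ 0
  n_ne : n 0 ≠ 0
  h_deriv : ∀ᶠ z in 𝓝 (0 : ℂ), HasDerivAt h (-A z / 24 - 8 * h z ^ 2) z
  A_deriv : ∀ᶠ z in 𝓝 (0 : ℂ), HasDerivAt A (6 * B z - 32 * h z * A z) z
  B_deriv : ∀ᶠ z in 𝓝 (0 : ℂ), HasDerivAt B (-48 * h z * B z - 4 / 3 * A z ^ 2) z
  n_deriv : ∀ᶠ z in 𝓝 (0 : ℂ), HasDerivAt n (-8 * h z * n z) z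
  A_eq : ∀ᶠ z in 𝓝 (0 : ℂ), A z = α (S z) * deriv S z ^ 2
  B_eq : ∀ᶠ z in 𝓝 (0 : ℂ), B z = β (S z) * deriv S z ^ 3

/-- A web `p^3 + α y^2 p + β y^3 = 0` that satisfies the flatness equations comes from a solution
of the Chazy system. -/
theorem exists_isWebPotential {α β G : ℂ → ℂ} (hα : AnalyticAt ℂ α 0) (hβ : AnalyticAt ℂ β 0)
    (hG : AnalyticAt ℂ G 0) (hα' : ∀ᶠ x in 𝓝 (0 : ℂ), HasDerivAt α (6 * β x - α x * G x) x)
    (hβ' : ∀ᶠ x in 𝓝 (0 : ℂ), HasDerivAt β (-(3 / 2) * G x * β x - 4 / 3 * α x ^ 2) x) :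
    ∃ h A B S n, IsWebPotential α β h A B S n := by
  -- The equation for `A'` gives `32h = GS' - 2S''/S'`, that is `h = p(Gp - 4p')/32` when `S' =
  -- p(S)²`. Then `h' = -A/24 - 8h²` becomes `p'' = Qp` with this `Q`. Of the initial values only
  -- `p(0) ≠ 0` matters.
  have hQ : AnalyticAt ℂ (fun x => deriv G x / 4 + α x / 3 + G x ^ 2 / 16) 0 :=
    ((hG.deriv.div_const).add hα.div_const).add (hG.pow 2).div_const
  obtain ⟨p, hp, hp0, -, hpp⟩ := exists_analyticAt_deriv_deriv_eq hQ 1 0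
  have hpne : ∀ᶠ x in 𝓝 (0 : ℂ), p x ≠ 0 := hp.continuousAt.eventually_ne (by simp [hp0])
  have hp2 : AnalyticAt ℂ (fun x => (p x ^ 2)⁻¹) 0 := (hp.pow 2).inv (by simp [hp0])
  -- `S` is the inverse of `Z = ∫ p⁻²`. With `P' = -G/4`, the function `p exp P` at `S` has
  -- logarithmic derivative `pp' - Gp²/4 = -8h`.
  obtain ⟨Z, hZ, hZ0, hZ'⟩ := exists_primitive hp2
  obtain ⟨P, hP, hP0, hP'⟩ := exists_primitive (f := fun x => -G x / 4) hG.neg.div_const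
  obtain ⟨S, hS, hS0, hS'⟩ := exists_local_inverse hZ hZ0 hZ'
    (hpne.mono fun x hx => inv_ne_zero (pow_ne_zero 2 hx))
  simp only [inv_inv] at hS'
  have hc : Tendsto S (𝓝 0) (𝓝 0) := by simpa [ContinuousAt, hS0] using hS.continuousAt
  have key : ∀ {F : ℂ → ℂ}, AnalyticAt ℂ F 0 → AnalyticAt ℂ (fun z => F (S z)) 0 := by
    intro F hF
    exact AnalyticAt.fun_comp (g := F) (f := S) (by rwa [hS0]) hS
  refine ⟨fun z => p (S z) * (G (S z) * p (S z) - 4 * deriv p (S z)) / 32,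
    fun z => α (S z) * p (S z) ^ 4, fun z => β (S z) * p (S z) ^ 6, S,
    fun z => p (S z) * Complex.exp (P (S z)), ?_⟩
  have d := hS'.and (hc.eventually (hpne.and (hpp.and ((hG.eventually_analyticAt).and
    ((hp.eventually_analyticAt).and (hP'.and (hα'.and hβ')))))))
  constructor
  · exact ((key hp).mul (((key hG).mul (key hp)).sub (analyticAt_const.mul (key hp.deriv)))).div_const
  · exact (key hα).mul ((key hp).pow 4)
  · exact (key hβ).mul ((key hp).pow 6)
  · exact hS
  · exact (key hp).mul (key hP).cexp
  · exact hS0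
  · rw [hS'.self_of_nhds.deriv, hS0, hp0]; norm_num
  · simp [hS0, hp0]
  · filter_upwards [d] with z ⟨hs, h1, h2, h3, h4, h5, h6, h7⟩
    have e1 := h4.differentiableAt.hasDerivAt
    have e2 := h4.deriv.differentiableAt.hasDerivAt
    have e3 := h3.differentiableAt.hasDerivAt
    have e := HasDerivAt.comp z (((e1.mul ((e3.mul e1).sub (e2.const_mul 4))).div_const 32)) hs
    refine e.congr_deriv ?_
    simp only [h2, Pi.mul_apply, Pi.sub_apply]
    ring
  · filter_upwards [d] with z ⟨hs, h1, h2, h3, h4, h5, h6, h7⟩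
    have e1 := h4.differentiableAt.hasDerivAt
    refine (HasDerivAt.comp z (h6.mul (e1.pow 4)) hs).congr_deriv ?_
    simp only [Pi.pow_apply]
    ring
  · filter_upwards [d] with z ⟨hs, h1, h2, h3, h4, h5, h6, h7⟩
    have e1 := h4.differentiableAt.hasDerivAt
    refine (HasDerivAt.comp z (h7.mul (e1.pow 6)) hs).congr_deriv ?_
    simp only [Pi.pow_apply]
    ring
  · filter_upwards [d] with z ⟨hs, h1, h2, h3, h4, h5, h6, h7⟩
    have e1 := h4.differentiableAt.hasDerivAt
    refine (HasDerivAt.comp z (e1.mul h5.cexp) hs).congr_deriv ?_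
    ring
  · filter_upwards [hS'] with z hz
    rw [hz.deriv]; ring
  · filter_upwards [hS'] with z hz
    rw [hz.deriv]; ring

/-! ### Möbius action on the solutions -/

/-- The action of the Möbius transformation `z ↦ z / (1 + t z)` on a component of weight `k`. -/
noncomputable def moebiusPull (k : ℕ) (F : ℂ → ℂ) (t z : ℂ) : ℂ :=
  (1 + t * z)⁻¹ ^ k * F (z * (1 + t * z)⁻¹)

/-- The action of the Möbius transformation `z ↦ z / (1 + t z)` on a solution of Chazy's
equation. -/
noncomputable def moebiusChazy (h : ℂ → ℂ) (t z : ℂ) : ℂ :=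
  moebiusPull 2 h t z + t / 8 * (1 + t * z)⁻¹

theorem analyticAt_moebiusPull {E : Type*} [NormedAddCommGroup E] [NormedSpace ℂ E] {F : ℂ → ℂ}
    (hF : AnalyticAt ℂ F 0) (k : ℕ) {t z : E → ℂ} {q : E} (ht : AnalyticAt ℂ t q)
    (hz : AnalyticAt ℂ z q) (h0 : z q = 0) :
    AnalyticAt ℂ (fun q => moebiusPull k F (t q) (z q)) q := by
  have h1 : AnalyticAt ℂ (fun q => (1 + t q * z q)⁻¹) q :=
    (analyticAt_const.add (ht.mul hz)).inv (by simp [h0])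
  exact (h1.pow k).mul (AnalyticAt.fun_comp (g := F) (by simpa [h0] using hF) (hz.mul h1))

theorem analyticAt_moebiusChazy {E : Type*} [NormedAddCommGroup E] [NormedSpace ℂ E] {F : ℂ → ℂ}
    (hF : AnalyticAt ℂ F 0) {t z : E → ℂ} {q : E} (ht : AnalyticAt ℂ t q)
    (hz : AnalyticAt ℂ z q) (h0 : z q = 0) :
    AnalyticAt ℂ (fun q => moebiusChazy F (t q) (z q)) q := by
  have h1 : AnalyticAt ℂ (fun q => (1 + t q * z q)⁻¹) q :=
    (analyticAt_const.add (ht.mul hz)).inv (by simp [h0])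
  exact (analyticAt_moebiusPull hF 2 ht hz h0).add (ht.div_const.mul h1)

theorem moebiusPull_zero_right (k : ℕ) (F : ℂ → ℂ) (t : ℂ) : moebiusPull k F t 0 = F 0 := by
  simp [moebiusPull]

theorem moebiusChazy_zero_right (h : ℂ → ℂ) (t : ℂ) : moebiusChazy h t 0 = h 0 + t / 8 := by
  simp [moebiusChazy, moebiusPull]

theorem hasDerivAt_moebius_inv {t z : ℂ} (hz : 1 + t * z ≠ 0) :
    HasDerivAt (fun z => (1 + t * z)⁻¹) (-t * (1 + t * z)⁻¹ ^ 2) z := by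
  have h := (((hasDerivAt_id' z).const_mul t).const_add 1).inv hz
  refine h.congr_deriv ?_
  field_simp

/-- The derivative of `z/(1 + tz)` is `(1 + tz)⁻²`, which raises the weight by two; the automorphy
factor contributes the term with `-kt`. -/
theorem hasDerivAt_moebiusPull {F : ℂ → ℂ} {F' t z : ℂ} (k : ℕ) (hz : 1 + t * z ≠ 0)
    (hF : HasDerivAt F F' (z * (1 + t * z)⁻¹)) :
    HasDerivAt (moebiusPull k F t)
      (-k * t * (1 + t * z)⁻¹ * moebiusPull k F t z + (1 + t * z)⁻¹ ^ (k + 2) * F') z := by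
  have h1 := hasDerivAt_moebius_inv hz
  have h2 := (hasDerivAt_id' z).mul h1
  have h3 := (h1.pow k).mul (HasDerivAt.comp z hF h2)
  refine h3.congr_deriv ?_
  have h4 : 1 * (1 + t * z)⁻¹ + z * (-t * (1 + t * z)⁻¹ ^ 2) = (1 + t * z)⁻¹ ^ 2 := by
    field_simp; ring
  simp only [Pi.pow_apply, Function.comp, moebiusPull, Pi.mul_apply, h4]
  -- The weight `0` is separated because differentiating the power brings in the truncated exponent
  -- `k - 1`.
  rcases k with _ | k
  · simp; ring
  · simp only [Nat.add_sub_cancel]; push_cast; ring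

/-- The shift `(t/8)(1 + tz)⁻¹` of `h` cancels the automorphy terms: the coefficients `-32`, `-48`,
`-8` of `h` in the equations for `A`, `B`, `n` turn it into `-4t`, `-6t`, `-t`, matching the weights
`4`, `6`, `1`. -/
theorem IsWebPotential.moebius {α β h A B S n : ℂ → ℂ} (H : IsWebPotential α β h A B S n)
    (t : ℂ) :
    IsWebPotential α β (moebiusChazy h t) (moebiusPull 4 A t) (moebiusPull 6 B t)
      (moebiusPull 0 S t) (moebiusPull 1 n t) := by
  have hc : Tendsto (fun z : ℂ => z * (1 + t * z)⁻¹) (𝓝 0) (𝓝 0) := by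
    have : ContinuousAt (fun z : ℂ => z * (1 + t * z)⁻¹) 0 :=
      continuousAt_id.mul ((by fun_prop : ContinuousAt (fun z : ℂ => 1 + t * z) 0).inv₀ (by simp))
    simpa [ContinuousAt] using this
  have hne : ∀ᶠ z in 𝓝 (0 : ℂ), 1 + t * z ≠ 0 :=
    (by fun_prop : ContinuousAt (fun z : ℂ => 1 + t * z) 0).eventually_ne (by simp)
  have hS : ∀ᶠ z in 𝓝 (0 : ℂ), deriv (moebiusPull 0 S t) z = moebiusPull 2 (deriv S) t z := by
    filter_upwards [hne, hc.eventually H.S_analytic.eventually_analyticAt] with z h1 h2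
    rw [(hasDerivAt_moebiusPull 0 h1 h2.differentiableAt.hasDerivAt).deriv]
    simp [moebiusPull]
  constructor
  · exact analyticAt_moebiusChazy H.h_analytic analyticAt_const analyticAt_id rfl
  · exact analyticAt_moebiusPull H.A_analytic 4 analyticAt_const analyticAt_id rfl
  · exact analyticAt_moebiusPull H.B_analytic 6 analyticAt_const analyticAt_id rfl
  · exact analyticAt_moebiusPull H.S_analytic 0 analyticAt_const analyticAt_id rfl
  · exact analyticAt_moebiusPull H.n_analytic 1 analyticAt_const analyticAt_id rfl
  · rw [moebiusPull_zero_right, H.S_zero]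
  · rw [hS.self_of_nhds, moebiusPull_zero_right]; exact H.S_deriv_ne
  · rw [moebiusPull_zero_right]; exact H.n_ne
  · filter_upwards [hne, hc.eventually H.h_deriv] with z h1 h2
    refine ((hasDerivAt_moebiusPull 2 h1 h2).add
      ((hasDerivAt_moebius_inv h1).const_mul (t / 8))).congr_deriv ?_
    simp only [moebiusChazy, moebiusPull]; push_cast; ring
  · filter_upwards [hne, hc.eventually H.A_deriv] with z h1 h2
    refine (hasDerivAt_moebiusPull 4 h1 h2).congr_deriv ?_
    simp only [moebiusChazy, moebiusPull]; push_cast; ring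
  · filter_upwards [hne, hc.eventually H.B_deriv] with z h1 h2
    refine (hasDerivAt_moebiusPull 6 h1 h2).congr_deriv ?_
    simp only [moebiusChazy, moebiusPull]; push_cast; ring
  · filter_upwards [hne, hc.eventually H.n_deriv] with z h1 h2
    refine (hasDerivAt_moebiusPull 1 h1 h2).congr_deriv ?_
    simp only [moebiusChazy, moebiusPull]; push_cast; ring
  · filter_upwards [hS, hc.eventually H.A_eq] with z h1 h2
    rw [h1]; simp only [moebiusPull, h2]; ring_nf
  · filter_upwards [hS, hc.eventually H.B_eq] with z h1 h2
    rw [h1]; simp only [moebiusPull, h2]; ring_nf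

/-! ### The Frobenius threefold of a solution of Chazy's equation -/

/-- The structure constants of the algebra with the basis `1, u, u ^ 2 - a * u - b`, where
`u ^ 3 = a * u ^ 2 + 2 * b * u + c` and `d = b ^ 2 - a * c`. -/
def cubicAlgebra (a b c d : ℂ) : Fin 3 → Fin 3 → Fin 3 → ℂ :=
  ![![![1, 0, 0], ![0, 1, 0], ![0, 0, 1]],
    ![![0, 1, 0], ![b, a, 1], ![c, b, 0]],
    ![![0, 0, 1], ![c, b, 0], ![d, c, 0]]]

/-- The antidiagonal matrix, which is the metric in flat coordinates. -/
def antiMetric : Matrix (Fin 3) (Fin 3) ℂ := !![0, 0, 1; 0, 1, 0; 1, 0, 0]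

/-- The derivative of `h`, for a solution `(h, A, B)` of the Chazy system. -/
noncomputable def chazy₁ (h A : ℂ → ℂ) (z : ℂ) : ℂ := -A z / 24 - 8 * h z ^ 2

/-- The second derivative of `h`, for a solution `(h, A, B)` of the Chazy system. -/
noncomputable def chazy₂ (h A B : ℂ → ℂ) (z : ℂ) : ℂ :=
  -B z / 4 + 2 * h z * A z + 128 * h z ^ 3

/-- The third derivative of `h`, for a solution `(h, A, B)` of the Chazy system. -/
noncomputable def chazy₃ (h A B : ℂ → ℂ) (z : ℂ) : ℂ :=
  24 * h z * B z + A z ^ 2 / 4 - 96 * A z * h z ^ 2 - 3072 * h z ^ 4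

/-- The multiplication with the potential `x ^ 2 * z / 2 + x * y ^ 2 / 2 + y ^ 4 * h z`. -/
noncomputable def chazyMul (h A B : ℂ → ℂ) (p : C3) : Fin 3 → Fin 3 → Fin 3 → ℂ :=
  cubicAlgebra (p 1 ^ 1 * (24 * h (p 2))) (p 1 ^ 2 * (12 * chazy₁ h A (p 2)))
    (p 1 ^ 3 * (4 * chazy₂ h A B (p 2))) (p 1 ^ 4 * (1 * chazy₃ h A B (p 2)))

theorem tangentMul_cubicAlgebra (a b c d : ℂ) (u v : C3) :
    tangentMul (cubicAlgebra a b c d) u v =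
      ![u 0 * v 0 + b * (u 1 * v 1) + c * (u 1 * v 2 + u 2 * v 1) + d * (u 2 * v 2),
        u 0 * v 1 + u 1 * v 0 + a * (u 1 * v 1) + b * (u 1 * v 2 + u 2 * v 1) + c * (u 2 * v 2),
        u 0 * v 2 + u 2 * v 0 + u 1 * v 1] := by
  ext k
  fin_cases k <;> simp [tangentMul, Fin.sum_univ_three, cubicAlgebra] <;> ring

theorem pairing_antiMetric (u v : C3) :
    pairing antiMetric u v = u 0 * v 2 + u 1 * v 1 + u 2 * v 0 := by
  simp [pairing, Fin.sum_univ_three, antiMetric]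

/-- This is `y⁴` times Chazy's equation, the value of the last structure constant that associativity
needs. As `chazy₃` is written through `h`, `A`, `B`, it is a polynomial identity. -/
theorem chazy_relation (h A B : ℂ → ℂ) (y z : ℂ) :
    y ^ 4 * (1 * chazy₃ h A B z) = (y ^ 2 * (12 * chazy₁ h A z)) ^ 2
      - y ^ 1 * (24 * h z) * (y ^ 3 * (4 * chazy₂ h A B z)) := by
  simp only [chazy₁, chazy₂, chazy₃]; ring

/-! ### Derivatives of the tensors in flat coordinates -/

theorem pd_const (i : Fin 3) (c : ℂ) (p : C3) : pd i (fun _ => c) p = 0 := by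
  simp [pd]

theorem pd_apply (i k : Fin 3) (p : C3) :
    pd i (fun q => q k) p = if k = i then 1 else 0 := by
  have h : HasFDerivAt (fun q : C3 => q k) (ContinuousLinearMap.proj (R := ℂ) k) p :=
    (ContinuousLinearMap.proj (R := ℂ) (φ := fun _ : Fin 3 => ℂ) k).hasFDerivAt
  rw [pd, h.fderiv]
  simp [Pi.single_apply]

/-- Every nonconstant entry is a power of `y` times a function of `z`. The redundant `^ 1` and `1 *`
in `chazyMul` and `chazyTensor` bring all four of them to this shape. -/
theorem pd_monomial {F : ℂ → ℂ} {F' : ℂ} {p : C3} (hF : HasDerivAt F F' (p 2)) (i : Fin 3)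
    (n : ℕ) (c : ℂ) :
    pd i (fun q => q 1 ^ n * (c * F (q 2))) p =
      if i = 1 then n * p 1 ^ (n - 1) * (c * F (p 2)) else
        if i = 2 then p 1 ^ n * (c * F') else 0 := by
  have h1 : HasFDerivAt (fun q : C3 => q 1) (ContinuousLinearMap.proj (R := ℂ) 1) p :=
    (ContinuousLinearMap.proj (R := ℂ) (φ := fun _ : Fin 3 => ℂ) 1).hasFDerivAt
  have h2 : HasFDerivAt (fun q : C3 => q 2) (ContinuousLinearMap.proj (R := ℂ) 2) p :=
    (ContinuousLinearMap.proj (R := ℂ) (φ := fun _ : Fin 3 => ℂ) 2).hasFDerivAt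
  have h3 := (h1.pow n).mul ((hF.comp_hasFDerivAt p h2).const_mul c)
  have h4 : pd i (fun q => q 1 ^ n * (c * F (q 2))) p = _ :=
    congrArg (fun L : C3 →L[ℂ] ℂ => L (Pi.single i 1)) h3.fderiv
  rw [h4]
  fin_cases i <;> simp
  ring

theorem christoffel_antiMetric (i j k : Fin 3) :
    christoffel (fun _ => antiMetric) i j k = fun _ => 0 := by
  ext p
  simp [christoffel, pd_const]

theorem covVec_antiMetric (V : C3 → C3) (i k : Fin 3) :
    covVec (fun _ => antiMetric) V i k = fun p => pd i (fun q => V q k) p := by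
  ext p
  simp [covVec, christoffel_antiMetric]

/-- The symmetric tensor of third derivatives of `x ^ 2 * z / 2 + x * y ^ 2 / 2 + f y z`. -/
def cubicTensor (a b c d : ℂ) : Fin 3 → Fin 3 → Fin 3 → ℂ :=
  ![![![0, 0, 1], ![0, 1, 0], ![1, 0, 0]],
    ![![0, 1, 0], ![1, a, b], ![0, b, c]],
    ![![1, 0, 0], ![0, b, c], ![0, c, d]]]

/-- The third derivatives of the potential `x ^ 2 * z / 2 + x * y ^ 2 / 2 + y ^ 4 * h z`. -/
noncomputable def chazyTensor (h A B : ℂ → ℂ) (p : C3) : Fin 3 → Fin 3 → Fin 3 → ℂ :=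
  cubicTensor (p 1 ^ 1 * (24 * h (p 2))) (p 1 ^ 2 * (12 * chazy₁ h A (p 2)))
    (p 1 ^ 3 * (4 * chazy₂ h A B (p 2))) (p 1 ^ 4 * (1 * chazy₃ h A B (p 2)))

theorem lowerMul_chazyMul (h A B : ℂ → ℂ) (i j k : Fin 3) :
    lowerMul (fun _ => antiMetric) (chazyMul h A B) i j k =
      fun p => chazyTensor h A B p i j k := by
  ext p
  fin_cases i <;> fin_cases j <;> fin_cases k <;>
    simp [lowerMul, Fin.sum_univ_three, antiMetric, chazyMul, cubicAlgebra, chazyTensor,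
      cubicTensor]

theorem cubicTensor_symm (a b c d : ℂ) (i j k : Fin 3) :
    cubicTensor a b c d i j k = cubicTensor a b c d j i k ∧
    cubicTensor a b c d i j k = cubicTensor a b c d i k j := by
  fin_cases i <;> fin_cases j <;> fin_cases k <;> simp [cubicTensor]

/-- The entries are third derivatives of one potential, for instance `∂_z(24yh) = ∂_y(12y²h')`. The
value of the derivative of `chazy₃` is not needed: `∂_z` of the last entry is only compared with
itself. -/
theorem chazyTensor_closed {h A B : ℂ → ℂ} {p : C3}
    (h₀ : HasDerivAt h (chazy₁ h A (p 2)) (p 2))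
    (h₁ : HasDerivAt (chazy₁ h A) (chazy₂ h A B (p 2)) (p 2))
    (h₂ : HasDerivAt (chazy₂ h A B) (chazy₃ h A B (p 2)) (p 2))
    (h₃ : DifferentiableAt ℂ (chazy₃ h A B) (p 2)) (l i j k : Fin 3) :
    pd l (fun p => chazyTensor h A B p i j k) p =
      pd i (fun p => chazyTensor h A B p l j k) p := by
  have e0 := fun i => pd_monomial h₀ i 1 24
  have e1 := fun i => pd_monomial h₁ i 2 12
  have e2 := fun i => pd_monomial h₂ i 3 4
  have e3 := fun i => pd_monomial h₃.hasDerivAt i 4 1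
  simp only [chazyTensor]
  generalize hf : (fun q : C3 => q 1 ^ 1 * (24 * h (q 2))) = f at e0
  generalize hf1 : (fun q : C3 => q 1 ^ 2 * (12 * chazy₁ h A (q 2))) = f1 at e1
  generalize hf2 : (fun q : C3 => q 1 ^ 3 * (4 * chazy₂ h A B (q 2))) = f2 at e2
  generalize hf3 : (fun q : C3 => q 1 ^ 4 * (1 * chazy₃ h A B (q 2))) = f3 at e3
  -- Subtracting the tensor with zero parameters removes the constant entries `1`, whose derivative
  -- vanishes.
  have hd : ∀ l i j k, pd l (fun p => cubicTensor (p 1 ^ 1 * (24 * h (p 2)))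
      (p 1 ^ 2 * (12 * chazy₁ h A (p 2))) (p 1 ^ 3 * (4 * chazy₂ h A B (p 2)))
      (p 1 ^ 4 * (1 * chazy₃ h A B (p 2))) i j k) p =
      cubicTensor (pd l f p) (pd l f1 p) (pd l f2 p) (pd l f3 p) i j k -
        cubicTensor 0 0 0 0 i j k := by
    intro l i j k
    subst hf hf1 hf2 hf3
    fin_cases i <;> fin_cases j <;> fin_cases k <;> simp [cubicTensor, pd_const]
  rw [hd, hd, e0, e1, e2, e3, e0, e1, e2, e3]
  fin_cases l <;> fin_cases i <;> fin_cases j <;> fin_cases k <;> simp [cubicTensor] <;> ring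

theorem hasDerivAt_chazy₁ {h A B : ℂ → ℂ} {z : ℂ} (hh : HasDerivAt h (chazy₁ h A z) z)
    (hA : HasDerivAt A (6 * B z - 32 * h z * A z) z) :
    HasDerivAt (chazy₁ h A) (chazy₂ h A B z) z := by
  refine ((hA.neg.div_const 24).sub ((hh.pow 2).const_mul 8)).congr_deriv ?_
  simp only [chazy₁, chazy₂]; push_cast; ring

theorem hasDerivAt_chazy₂ {h A B : ℂ → ℂ} {z : ℂ} (hh : HasDerivAt h (chazy₁ h A z) z)
    (hA : HasDerivAt A (6 * B z - 32 * h z * A z) z)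
    (hB : HasDerivAt B (-48 * h z * B z - 4 / 3 * A z ^ 2) z) :
    HasDerivAt (chazy₂ h A B) (chazy₃ h A B z) z := by
  refine (((hB.neg.div_const 4).add ((hh.const_mul 2).mul hA)).add
    ((hh.pow 3).const_mul 128)).congr_deriv ?_
  simp only [chazy₁, chazy₃]; push_cast; ring

theorem analyticAt_cubicAlgebra {E : Type*} [NormedAddCommGroup E] [NormedSpace ℂ E]
    {a b c d : E → ℂ} {q : E} (ha : AnalyticAt ℂ a q) (hb : AnalyticAt ℂ b q)
    (hc : AnalyticAt ℂ c q) (hd : AnalyticAt ℂ d q) (i j k : Fin 3) :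
    AnalyticAt ℂ (fun q => cubicAlgebra (a q) (b q) (c q) (d q) i j k) q := by
  fin_cases i <;> fin_cases j <;> fin_cases k <;> simp [cubicAlgebra] <;>
    first | assumption | exact analyticAt_const

theorem analyticAt_coord {m : ℕ} (k : Fin m) (p : Fin m → ℂ) :
    AnalyticAt ℂ (fun q : Fin m → ℂ => q k) p :=
  (ContinuousLinearMap.proj (R := ℂ) (φ := fun _ : Fin m => ℂ) k).analyticAt p

/-- Joint analyticity of the structure constants in a point and in parameters. -/
theorem analyticAt_chazyMul {E : Type*} [NormedAddCommGroup E] [NormedSpace ℂ E]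
    {h A B : E → ℂ → ℂ} {p : E → C3} {q : E}
    (hh : AnalyticAt ℂ (fun q => h q (p q 2)) q) (hA : AnalyticAt ℂ (fun q => A q (p q 2)) q)
    (hB : AnalyticAt ℂ (fun q => B q (p q 2)) q) (hp : AnalyticAt ℂ (fun q => p q 1) q)
    (i j k : Fin 3) :
    AnalyticAt ℂ (fun q => chazyMul (h q) (A q) (B q) (p q) i j k) q := by
  have h₁ : AnalyticAt ℂ (fun q => chazy₁ (h q) (A q) (p q 2)) q :=
    hA.neg.div_const.sub (analyticAt_const.mul (hh.pow 2))
  have h₂ : AnalyticAt ℂ (fun q => chazy₂ (h q) (A q) (B q) (p q 2)) q :=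
    (hB.neg.div_const.add ((analyticAt_const.mul hh).mul hA)).add (analyticAt_const.mul (hh.pow 3))
  have h₃ : AnalyticAt ℂ (fun q => chazy₃ (h q) (A q) (B q) (p q 2)) q :=
    ((((analyticAt_const.mul hh).mul hB).add (hA.pow 2).div_const).sub
      ((analyticAt_const.mul hA).mul (hh.pow 2))).sub (analyticAt_const.mul (hh.pow 4))
  exact analyticAt_cubicAlgebra ((hp.pow 1).mul (analyticAt_const.mul hh))
    ((hp.pow 2).mul (analyticAt_const.mul h₁)) ((hp.pow 3).mul (analyticAt_const.mul h₂))
    ((hp.pow 4).mul (analyticAt_const.mul h₃)) i j k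

/-- Euler's relation in `y`: the parameters are homogeneous of degrees `1`, `2`, `3`, `4`, and the
subtracted term removes the constant entries. -/
theorem pd_chazyMul {h A B : ℂ → ℂ} {p : C3}
    (h₀ : DifferentiableAt ℂ h (p 2)) (hA : DifferentiableAt ℂ A (p 2))
    (hB : DifferentiableAt ℂ B (p 2)) (i j k : Fin 3) :
    pd 0 (fun p => chazyMul h A B p i j k) p = 0 ∧
    p 1 * pd 1 (fun p => chazyMul h A B p i j k) p =
      cubicAlgebra (p 1 ^ 1 * (24 * h (p 2))) (2 * (p 1 ^ 2 * (12 * chazy₁ h A (p 2))))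
        (3 * (p 1 ^ 3 * (4 * chazy₂ h A B (p 2)))) (4 * (p 1 ^ 4 * (1 * chazy₃ h A B (p 2)))) i j k
        - cubicAlgebra 0 0 0 0 i j k := by
  have h₁ : DifferentiableAt ℂ (chazy₁ h A) (p 2) := by unfold chazy₁; fun_prop
  have h₂ : DifferentiableAt ℂ (chazy₂ h A B) (p 2) := by unfold chazy₂; fun_prop
  have h₃ : DifferentiableAt ℂ (chazy₃ h A B) (p 2) := by unfold chazy₃; fun_prop
  have e0 := fun i => pd_monomial h₀.hasDerivAt i 1 24
  have e1 := fun i => pd_monomial h₁.hasDerivAt i 2 12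
  have e2 := fun i => pd_monomial h₂.hasDerivAt i 3 4
  have e3 := fun i => pd_monomial h₃.hasDerivAt i 4 1
  simp only [chazyMul]
  generalize hf : (fun q : C3 => q 1 ^ 1 * (24 * h (q 2))) = f at e0
  generalize hf1 : (fun q : C3 => q 1 ^ 2 * (12 * chazy₁ h A (q 2))) = f1 at e1
  generalize hf2 : (fun q : C3 => q 1 ^ 3 * (4 * chazy₂ h A B (q 2))) = f2 at e2
  generalize hf3 : (fun q : C3 => q 1 ^ 4 * (1 * chazy₃ h A B (q 2))) = f3 at e3
  have hd : ∀ l i j k, pd l (fun p => cubicAlgebra (p 1 ^ 1 * (24 * h (p 2)))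
      (p 1 ^ 2 * (12 * chazy₁ h A (p 2))) (p 1 ^ 3 * (4 * chazy₂ h A B (p 2)))
      (p 1 ^ 4 * (1 * chazy₃ h A B (p 2))) i j k) p =
      cubicAlgebra (pd l f p) (pd l f1 p) (pd l f2 p) (pd l f3 p) i j k -
        cubicAlgebra 0 0 0 0 i j k := by
    intro l i j k
    subst hf hf1 hf2 hf3
    fin_cases i <;> fin_cases j <;> fin_cases k <;> simp [cubicAlgebra, pd_const]
  rw [hd, hd, e0, e1, e2, e3, e0, e1, e2, e3]
  constructor
  · fin_cases i <;> fin_cases j <;> fin_cases k <;> simp [cubicAlgebra]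
  · fin_cases i <;> fin_cases j <;> fin_cases k <;> simp [cubicAlgebra] <;> ring

/-- The Euler field `2 x ∂_x + y ∂_y`. -/
noncomputable def chazyEuler (p : C3) : C3 := ![2 * p 0, p 1, 0]

theorem pd_chazyEuler (i k : Fin 3) (p : C3) :
    pd i (fun q => chazyEuler q k) p = if i = k then ![2, 1, 0] k else 0 := by
  have h : pd i (fun q : C3 => 2 * q 0) p = 2 * pd i (fun q => q 0) p := by
    simp only [pd]
    rw [fderiv_const_mul (by fun_prop)]
    rfl
  fin_cases k
  · simp only [chazyEuler, Matrix.cons_val_zero, Fin.zero_eta]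
    rw [h, pd_apply]
    fin_cases i <;> simp
  · simp only [chazyEuler, Matrix.cons_val_one, Fin.mk_one, Matrix.cons_val_zero, pd_apply]
    fin_cases i <;> simp
  · simp [chazyEuler, pd_const]

/-- Give `x`, `y`, `z` the weights `2`, `1`, `0`. An entry `m i j k` of degree `δ` in `y` is scaled
by `δ + w_i + w_j - w_k`, which is `2` for every nonzero entry. -/
theorem lieMul_chazyMul {h A B : ℂ → ℂ} {p : C3}
    (h₀ : DifferentiableAt ℂ h (p 2)) (hA : DifferentiableAt ℂ A (p 2))
    (hB : DifferentiableAt ℂ B (p 2)) (i j k : Fin 3) :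
    lieMul chazyEuler (chazyMul h A B) i j k p = 2 * chazyMul h A B p i j k := by
  obtain ⟨e0, e1⟩ := pd_chazyMul h₀ hA hB i j k
  simp only [lieMul, Fin.sum_univ_three, pd_chazyEuler, e0]
  rw [show chazyEuler p 1 = p 1 from rfl, e1, show chazyEuler p 2 = 0 from rfl]
  simp only [chazyMul]
  fin_cases i <;> fin_cases j <;> fin_cases k <;> simp [cubicAlgebra] <;> ring

theorem IsWebPotential.eventually_hasDerivAt {α β h A B S n : ℂ → ℂ}
    (H : IsWebPotential α β h A B S n) : ∀ᶠ p in 𝓝 (0 : C3),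
      HasDerivAt h (chazy₁ h A (p 2)) (p 2) ∧
      HasDerivAt A (6 * B (p 2) - 32 * h (p 2) * A (p 2)) (p 2) ∧
      HasDerivAt B (-48 * h (p 2) * B (p 2) - 4 / 3 * A (p 2) ^ 2) (p 2) := by
  have hc : Tendsto (fun p : C3 => p 2) (𝓝 0) (𝓝 0) :=
    (continuous_apply (2 : Fin 3)).tendsto (0 : C3)
  exact hc.eventually (H.h_deriv.and (H.A_deriv.and H.B_deriv))

/-- The germ of a Frobenius threefold with the potential
`x ^ 2 * z / 2 + x * y ^ 2 / 2 + y ^ 4 * h z`. -/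
noncomputable def chazyGerm {α β h A B S n : ℂ → ℂ} (H : IsWebPotential α β h A B S n) :
    FrobeniusGerm where
  metric := fun _ => antiMetric
  mul := chazyMul h A B
  unit := fun _ => ![1, 0, 0]
  euler := chazyEuler
  metricWeight := 2
  mulWeight := 2
  metric_analytic := fun _ _ => analyticAt_const
  mul_analytic := fun i j k => by
    have h2 : AnalyticAt ℂ (fun p : C3 => p 2) 0 := analyticAt_coord 2 0
    exact analyticAt_chazyMul (h := fun _ => h) (A := fun _ => A) (B := fun _ => B) (p := fun p => p)
      (AnalyticAt.fun_comp (g := h) (by exact H.h_analytic) h2)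
      (AnalyticAt.fun_comp (g := A) (by exact H.A_analytic) h2)
      (AnalyticAt.fun_comp (g := B) (by exact H.B_analytic) h2) (analyticAt_coord 1 0) i j k
  unit_analytic := fun _ => analyticAt_const
  euler_analytic := fun i => by
    fin_cases i
    · exact analyticAt_const.mul (analyticAt_coord 0 0)
    · exact analyticAt_coord 1 0
    · exact analyticAt_const
  mul_comm := Eventually.of_forall fun p u v => by
    simp only [chazyMul, tangentMul_cubicAlgebra]
    ext k
    fin_cases k <;> simp <;> ring
  mul_assoc := Eventually.of_forall fun p u v w => by
    simp only [chazyMul, tangentMul_cubicAlgebra, chazy_relation]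
    ext k
    fin_cases k <;> simp <;> ring
  metric_symm := Eventually.of_forall fun p => by
    ext i j
    fin_cases i <;> fin_cases j <;> rfl
  metric_nondegenerate := Eventually.of_forall fun p => by
    simp [antiMetric, Matrix.det_fin_three]
  metric_invariant := Eventually.of_forall fun p u v w => by
    simp only [chazyMul, tangentMul_cubicAlgebra, pairing_antiMetric, Matrix.cons_val]
    ring
  metric_flat := Eventually.of_forall fun p i j l k => by
    simp [curvature, christoffel_antiMetric, pd_const]
  unit_mul := Eventually.of_forall fun p v => by
    simp only [chazyMul, tangentMul_cubicAlgebra]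
    ext k
    fin_cases k <;> simp
  unit_parallel := Eventually.of_forall fun p i k => by
    rw [covVec_antiMetric]
    exact pd_const i _ p
  euler_linear := Eventually.of_forall fun p l i k => by
    simp only [covCovVec, covVec_antiMetric, christoffel_antiMetric, pd_chazyEuler, pd_const]
    simp
  euler_metric := Eventually.of_forall fun p i j => by
    simp only [lieMetric, pd_chazyEuler, pd_const, Fin.sum_univ_three]
    fin_cases i <;> fin_cases j <;> simp [antiMetric] <;> norm_num
  euler_mul := H.eventually_hasDerivAt.mono fun p ⟨h₀, hA, hB⟩ i j k =>
    lieMul_chazyMul h₀.differentiableAt hA.differentiableAt hB.differentiableAt i j k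
  mulWeight_ne_zero := two_ne_zero
  potential := H.eventually_hasDerivAt.mono fun p ⟨h₀, hA, hB⟩ l i j k => by
    have hd : DifferentiableAt ℂ (chazy₃ h A B) (p 2) := by
      have h0' := h₀.differentiableAt
      have hA' := hA.differentiableAt
      have hB' := hB.differentiableAt
      unfold chazy₃; fun_prop
    have hcl := chazyTensor_closed h₀ (hasDerivAt_chazy₁ h₀ hA) (hasDerivAt_chazy₂ h₀ hA hB) hd
    have hs : ∀ i j k, (fun p => chazyTensor h A B p i j k) = fun p => chazyTensor h A B p j i k :=
      fun i j k => funext fun p => (cubicTensor_symm _ _ _ _ i j k).1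
    have hs' : ∀ i j k, (fun p => chazyTensor h A B p i j k) = fun p => chazyTensor h A B p i k j :=
      fun i j k => funext fun p => (cubicTensor_symm _ _ _ _ i j k).2
    simp only [covMul, christoffel_antiMetric, lowerMul_chazyMul, zero_mul, add_zero,
      Finset.sum_const_zero, sub_zero]
    exact ⟨hcl l i j k, by rw [hs], by rw [hs']⟩

/-! ### Idempotents and the directions of the booklet web -/

theorem tangentMul_add_right (m : Fin 3 → Fin 3 → Fin 3 → ℂ) (u v w : C3) :
    tangentMul m u (v + w) = tangentMul m u v + tangentMul m u w := by
  ext k; simp [tangentMul, Fin.sum_univ_three]; ring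

theorem tangentMul_add_left (m : Fin 3 → Fin 3 → Fin 3 → ℂ) (u v w : C3) :
    tangentMul m (u + v) w = tangentMul m u w + tangentMul m v w := by
  ext k; simp [tangentMul, Fin.sum_univ_three]; ring

theorem tangentMul_smul_right (m : Fin 3 → Fin 3 → Fin 3 → ℂ) (s : ℂ) (u v : C3) :
    tangentMul m u (s • v) = s • tangentMul m u v := by
  ext k; simp [tangentMul, Fin.sum_univ_three]; ring

theorem tangentMul_smul_left (m : Fin 3 → Fin 3 → Fin 3 → ℂ) (s : ℂ) (u v : C3) :
    tangentMul m (s • u) v = s • tangentMul m u v := by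
  ext k; simp [tangentMul, Fin.sum_univ_three]; ring

theorem exists_eq_sum_of_linearIndependent {ε : Fin 3 → C3} (hε : LinearIndependent ℂ ε) (v : C3) :
    ∃ s : Fin 3 → ℂ, v = s 0 • ε 0 + s 1 • ε 1 + s 2 • ε 2 := by
  have h : Submodule.span ℂ (Set.range ε) = ⊤ :=
    hε.span_eq_top_of_card_eq_finrank' (by simp)
  obtain ⟨s, hs⟩ := (Submodule.mem_span_range_iff_exists_fun ℂ).1 (h ▸ Submodule.mem_top (x := v))
  exact ⟨s, by rw [← hs, Fin.sum_univ_three]⟩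

/-- The eigenvectors of the multiplication by the generator of the algebra. -/
theorem eigenvector_cubicAlgebra {a b c d r : ℂ} {v : C3}
    (h : tangentMul (cubicAlgebra a b c d) ![0, 1, 0] v = r • v) (hv : v ≠ 0) :
    v 1 = r * v 2 ∧ v 2 ≠ 0 ∧ r ^ 3 = a * r ^ 2 + 2 * b * r + c := by
  rw [tangentMul_cubicAlgebra] at h
  have h0 := congrFun h 0
  have h1 := congrFun h 1
  have h2 := congrFun h 2
  simp at h0 h1 h2
  have hv2 : v 2 ≠ 0 := by
    intro hz
    have hv1 : v 1 = 0 := by rw [h2, hz, mul_zero]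
    have hv0 : v 0 = 0 := by simpa [hv1, hz] using h1
    exact hv (by ext k; fin_cases k <;> assumption)
  refine ⟨h2, hv2, mul_right_cancel₀ hv2 ?_⟩
  linear_combination -h0 - r * h1 + (b + a * r - r ^ 2) * h2

/-- The zeros of the binary cubic form of the algebra are the directions of the planes spanned by
the unity and an idempotent. -/
theorem cubic_eq_zero_iff_mem_span {a b c d : ℂ} {ε : Fin 3 → C3} (hε : LinearIndependent ℂ ε)
    (hm : ∀ i j, tangentMul (cubicAlgebra a b c d) (ε i) (ε j) = if i = j then ε i else 0)
    (w : C3) :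
    w 1 ^ 3 - a * w 1 ^ 2 * w 2 - 2 * b * w 1 * w 2 ^ 2 - c * w 2 ^ 3 = 0 ↔
      ∃ i, w ∈ Submodule.span ℂ {(![1, 0, 0] : C3), ε i} := by
  obtain ⟨r, hr⟩ := exists_eq_sum_of_linearIndependent hε ![0, 1, 0]
  have hev : ∀ i, tangentMul (cubicAlgebra a b c d) ![0, 1, 0] (ε i) = r i • ε i := by
    intro i
    rw [hr]
    simp only [tangentMul_add_left, tangentMul_smul_left, hm]
    fin_cases i <;> simp
  have hei := fun i => eigenvector_cubicAlgebra (hev i) (hε.ne_zero i)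
  constructor
  · intro hw
    -- Here the cubic leaves `w 1 = 0`, so `w` is a multiple of the unity and lies in all three
    -- planes; the index `0` is arbitrary.
    by_cases hw2 : w 2 = 0
    · have hw1 : w 1 = 0 := by simpa [hw2] using hw
      refine ⟨0, Submodule.mem_span_pair.2 ⟨w 0, 0, ?_⟩⟩
      ext k; fin_cases k <;> simp [hw1, hw2]
    · set t := w 1 / w 2 with ht
      have hw1 : w 1 = t * w 2 := by rw [ht]; field_simp
      have hP : t ^ 3 = a * t ^ 2 + 2 * b * t + c := by
        refine mul_right_cancel₀ (pow_ne_zero 3 hw2) ?_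
        rw [hw1] at hw
        linear_combination hw
      -- With `P(u) = u³ - au² - 2bu - c`, this vector is the quotient `P(u)/(u - t)`, so it is an
      -- eigenvector for `t`. Its expansion must involve an idempotent with eigenvalue `t`.
      obtain ⟨s, hs⟩ := exists_eq_sum_of_linearIndependent hε ![t ^ 2 - a * t - b, t, 1]
      have h1 : tangentMul (cubicAlgebra a b c d) ![0, 1, 0] ![t ^ 2 - a * t - b, t, 1]
          = t • ![t ^ 2 - a * t - b, t, 1] := by
        rw [tangentMul_cubicAlgebra]
        ext k; fin_cases k <;> simp
        · linear_combination -hP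
        · ring
      rw [hs] at h1
      simp only [tangentMul_add_right, tangentMul_smul_right, hev] at h1
      have h2 := Fintype.linearIndependent_iff.1 hε (fun i => s i * (r i - t)) (by
        rw [Fin.sum_univ_three]
        rw [← sub_eq_zero] at h1
        rw [← h1]
        module)
      obtain ⟨i, hi⟩ : ∃ i, s i ≠ 0 := by
        by_contra! hall
        have := congrFun hs 2
        simp [hall] at this
      have hri : r i = t := by
        have := (mul_eq_zero.1 (h2 i)).resolve_left hi
        exact sub_eq_zero.1 this
      obtain ⟨e1, e2, -⟩ := hei i
      refine ⟨i, Submodule.mem_span_pair.2 ⟨w 0 - w 2 / ε i 2 * ε i 0, w 2 / ε i 2, ?_⟩⟩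
      ext k; fin_cases k <;> simp
      · rw [hw1, e1, hri]; field_simp
      · field_simp
  · rintro ⟨i, hi⟩
    obtain ⟨s, t, rfl⟩ := Submodule.mem_span_pair.1 hi
    obtain ⟨e1, -, e3⟩ := hei i
    simp [e1]
    linear_combination (t * ε i 2) ^ 3 * e3

/-- An algebra with three different roots is semisimple. -/
theorem exists_idempotents {x y z : ℂ} (hxy : x ≠ y) (hxz : x ≠ z) (hyz : y ≠ z) {a b c d : ℂ}
    (ha : a = x + y + z) (hb : 2 * b = -(x * y + y * z + z * x)) (hc : c = x * y * z)
    (hd : d = b ^ 2 - a * c) :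
    ∃ ε : Fin 3 → C3, LinearIndependent ℂ ε ∧
      ∀ i j, tangentMul (cubicAlgebra a b c d) (ε i) (ε j) = if i = j then ε i else 0 := by
  -- At a root `r`, `W r` is `P(u)/(u - r)` for `P(u) = u³ - au² - 2bu - c`. The idempotents are `W
  -- r / P'(r)`, as in Lagrange interpolation.
  set W : ℂ → C3 := fun r => ![r ^ 2 - a * r - b, r, 1] with hW
  have h1 : x - y ≠ 0 := sub_ne_zero.2 hxy
  have h2 : x - z ≠ 0 := sub_ne_zero.2 hxz
  have h3 : y - z ≠ 0 := sub_ne_zero.2 hyz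
  have hWW : ∀ r s, s ^ 3 = a * s ^ 2 + 2 * b * s + c →
      tangentMul (cubicAlgebra a b c d) (W r) (W s) =
        (r ^ 2 + r * s + s ^ 2 - a * (r + s) - 2 * b) • W s := by
    intro r s hs
    rw [tangentMul_cubicAlgebra]
    ext k; fin_cases k <;> simp [W, hd]
    · linear_combination (-r + a - s) * hs
    · linear_combination -hs
    · ring
  have px : x ^ 3 = a * x ^ 2 + 2 * b * x + c := by rw [ha, hb, hc]; ring
  have py : y ^ 3 = a * y ^ 2 + 2 * b * y + c := by rw [ha, hb, hc]; ring
  have pz : z ^ 3 = a * z ^ 2 + 2 * b * z + c := by rw [ha, hb, hc]; ring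
  have h1' : y - x ≠ 0 := sub_ne_zero.2 hxy.symm
  have h2' : z - x ≠ 0 := sub_ne_zero.2 hxz.symm
  have h3' : z - y ≠ 0 := sub_ne_zero.2 hyz.symm
  have exx : x ^ 2 + x * x + x ^ 2 - a * (x + x) - 2 * b = (x - y) * (x - z) := by
    rw [ha, hb]; ring
  have eyy : y ^ 2 + y * y + y ^ 2 - a * (y + y) - 2 * b = (y - x) * (y - z) := by
    rw [ha, hb]; ring
  have ezz : z ^ 2 + z * z + z ^ 2 - a * (z + z) - 2 * b = (z - x) * (z - y) := by
    rw [ha, hb]; ring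
  have exy : x ^ 2 + x * y + y ^ 2 - a * (x + y) - 2 * b = 0 := by rw [ha, hb]; ring
  have exz : x ^ 2 + x * z + z ^ 2 - a * (x + z) - 2 * b = 0 := by rw [ha, hb]; ring
  have eyx : y ^ 2 + y * x + x ^ 2 - a * (y + x) - 2 * b = 0 := by rw [ha, hb]; ring
  have eyz : y ^ 2 + y * z + z ^ 2 - a * (y + z) - 2 * b = 0 := by rw [ha, hb]; ring
  have ezx : z ^ 2 + z * x + x ^ 2 - a * (z + x) - 2 * b = 0 := by rw [ha, hb]; ring
  have ezy : z ^ 2 + z * y + y ^ 2 - a * (z + y) - 2 * b = 0 := by rw [ha, hb]; ring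
  set ε : Fin 3 → C3 := ![((x - y) * (x - z))⁻¹ • W x, ((y - x) * (y - z))⁻¹ • W y,
    ((z - x) * (z - y))⁻¹ • W z] with hε
  have hm : ∀ i j, tangentMul (cubicAlgebra a b c d) (ε i) (ε j) = if i = j then ε i else 0 := by
    have Wx := fun r => hWW r x px
    have Wy := fun r => hWW r y py
    have Wz := fun r => hWW r z pz
    clear_value W
    have nx : (x - y) * (x - z) ≠ 0 := mul_ne_zero h1 h2
    have ny : (y - x) * (y - z) ≠ 0 := mul_ne_zero h1' h3
    have nz : (z - x) * (z - y) ≠ 0 := mul_ne_zero h2' h3'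
    intro i j
    rw [hε]
    fin_cases i <;> fin_cases j <;>
      simp only [Fin.zero_eta, Fin.mk_one, Fin.reduceFinMk, Fin.isValue, Matrix.cons_val,
        tangentMul_smul_left, tangentMul_smul_right, Wx, Wy, Wz, exx, exy, exz, eyx, eyy, eyz,
        ezx, ezy, ezz, smul_smul, zero_smul, smul_zero] <;>
      simp [← mul_assoc, h1, h2, h3, h1', h2', h3']
  refine ⟨ε, Fintype.linearIndependent_iff.2 fun g hg i => ?_, hm⟩
  -- Multiplication by `ε i` isolates the `i`-th term of the relation, and the last coordinate of `ε
  -- i` is nonzero.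
  have h := congrArg (fun v => tangentMul (cubicAlgebra a b c d) v (ε i)) hg
  simp only [Fin.sum_univ_three, tangentMul_add_left, tangentMul_smul_left, hm] at h
  have h0 : tangentMul (cubicAlgebra a b c d) 0 (ε i) = 0 := by
    ext k; simp [tangentMul]
  rw [h0] at h
  have h4 := congrFun h 2
  fin_cases i <;> simpa [ε, W, h1, h2, h3, h1', h2', h3'] using h4

theorem exists_three_roots {A B : ℂ} (h : 4 * A ^ 3 + 27 * B ^ 2 ≠ 0) :
    ∃ x y z : ℂ, x ≠ y ∧ x ≠ z ∧ y ≠ z ∧ x + y + z = 0 ∧ x * y + y * z + z * x = A ∧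
      x * y * z = -B := by
  set P : Cubic ℂ := ⟨1, 0, A, B⟩
  have ha : P.a ≠ 0 := one_ne_zero
  obtain ⟨x, y, z, h3⟩ := (Cubic.splits_iff_roots_eq_three (φ := RingHom.id ℂ) ha).1
    (IsAlgClosed.splits _)
  have eb := Cubic.b_eq_three_roots ha h3
  have ec := Cubic.c_eq_three_roots ha h3
  have ed := Cubic.d_eq_three_roots ha h3
  have hd := (Cubic.discr_ne_zero_iff_roots_ne ha h3).1 (by
    simp only [Cubic.discr, P]
    contrapose! h
    linear_combination -h)
  simp only [P, RingHom.id_apply, one_mul] at eb ec ed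
  exact ⟨x, y, z, hd.1, hd.2.1, hd.2.2, by linear_combination eb, by linear_combination -ec,
    by linear_combination ed⟩

/-- The roots of the algebra at `p` are `y(x_i + 8h)`, where the `x_i` are the roots of `X³ + AX +
B`; they are distinct when `y` and the discriminant do not vanish. -/
theorem isSemisimpleAt_chazyGerm {α β h A B S n : ℂ → ℂ} (H : IsWebPotential α β h A B S n)
    {p : C3} (hp : p 1 ≠ 0) (hd : 4 * A (p 2) ^ 3 + 27 * B (p 2) ^ 2 ≠ 0) :
    (chazyGerm H).IsSemisimpleAt p := by
  obtain ⟨x, y, z, hxy, hxz, hyz, e1, e2, e3⟩ := exists_three_roots hd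
  have key : ∀ {x y : ℂ}, x ≠ y → p 1 * (x + 8 * h (p 2)) ≠ p 1 * (y + 8 * h (p 2)) :=
    fun hne he => hne (add_right_cancel (mul_left_cancel₀ hp he))
  refine exists_idempotents (key hxy) (key hxz) (key hyz) ?_ ?_ ?_ (chazy_relation h A B _ _)
  · linear_combination -(p 1) * e1
  · rw [chazy₁]
    linear_combination (p 1 ^ 2) * e2 + 16 * h (p 2) * p 1 ^ 2 * e1
  · rw [chazy₂]
    linear_combination -(p 1 ^ 3) * e3 - 8 * h (p 2) * p 1 ^ 3 * e2 -
      64 * h (p 2) ^ 2 * p 1 ^ 3 * e1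

/-! ### Cubic forms on transverse surfaces -/

/-- The pull-back under `v ↦ (z 0 * v 0 + z 1 * v 1, y 0 * v 0 + y 1 * v 1)` of the binary form
`dy ^ 3 - a * dy ^ 2 * dz - 2 * b * dy * dz ^ 2 - c * dz ^ 3`. -/
def pullCubic (a b c : C2 → ℂ) (y z : C2 → C2) : CubicForm :=
  ![fun q => y q 0 ^ 3 - a q * y q 0 ^ 2 * z q 0 - 2 * b q * y q 0 * z q 0 ^ 2 - c q * z q 0 ^ 3,
    fun q => 3 * y q 0 ^ 2 * y q 1 - a q * (2 * y q 0 * y q 1 * z q 0 + y q 0 ^ 2 * z q 1)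
      - 2 * b q * (y q 1 * z q 0 ^ 2 + 2 * y q 0 * z q 0 * z q 1) - 3 * c q * z q 0 ^ 2 * z q 1,
    fun q => 3 * y q 0 * y q 1 ^ 2 - a q * (2 * y q 0 * y q 1 * z q 1 + y q 1 ^ 2 * z q 0)
      - 2 * b q * (y q 0 * z q 1 ^ 2 + 2 * y q 1 * z q 0 * z q 1) - 3 * c q * z q 0 * z q 1 ^ 2,
    fun q => y q 1 ^ 3 - a q * y q 1 ^ 2 * z q 1 - 2 * b q * y q 1 * z q 1 ^ 2 - c q * z q 1 ^ 3]

theorem eval_pullCubic (a b c : C2 → ℂ) (y z : C2 → C2) (q v : C2) :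
    (pullCubic a b c y z).eval q v =
      (y q 0 * v 0 + y q 1 * v 1) ^ 3
        - a q * (y q 0 * v 0 + y q 1 * v 1) ^ 2 * (z q 0 * v 0 + z q 1 * v 1)
        - 2 * b q * (y q 0 * v 0 + y q 1 * v 1) * (z q 0 * v 0 + z q 1 * v 1) ^ 2
        - c q * (z q 0 * v 0 + z q 1 * v 1) ^ 3 := by
  simp [CubicForm.eval, pullCubic, Fin.sum_univ_four]
  ring

theorem eval_monicCubic (S A B : C2 → ℂ) (q v : C2) :
    (monicCubic S A B).eval q v =
      v 1 ^ 3 + S q * v 1 ^ 2 * v 0 + A q * v 1 * v 0 ^ 2 + B q * v 0 ^ 3 := by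
  simp [CubicForm.eval, monicCubic, Fin.sum_univ_four]
  ring

theorem analyticAt_pullCubic {a b c : C2 → ℂ} {y z : C2 → C2} {q : C2} (ha : AnalyticAt ℂ a q)
    (hb : AnalyticAt ℂ b q) (hc : AnalyticAt ℂ c q) (hy : ∀ j, AnalyticAt ℂ (fun q => y q j) q)
    (hz : ∀ j, AnalyticAt ℂ (fun q => z q j) q) (i : Fin 4) :
    AnalyticAt ℂ (pullCubic a b c y z i) q := by
  have k := fun t : ℂ => (analyticAt_const : AnalyticAt ℂ (fun _ : C2 => t) q)
  have hy0 := hy 0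
  have hy1 := hy 1
  have hz0 := hz 0
  have hz1 := hz 1
  fin_cases i
  · exact (((hy0.pow 3).sub ((ha.mul (hy0.pow 2)).mul hz0)).sub
      (((((k 2).mul hb).mul hy0)).mul (hz0.pow 2))).sub (hc.mul (hz0.pow 3))
  · exact (((((k 3).mul (hy0.pow 2)).mul hy1).sub
      (ha.mul (((((k 2).mul hy0).mul hy1).mul hz0).add ((hy0.pow 2).mul hz1)))).sub
      (((k 2).mul hb).mul ((hy1.mul (hz0.pow 2)).add ((((k 2).mul hy0).mul hz0).mul hz1)))).sub
      ((((k 3).mul hc).mul (hz0.pow 2)).mul hz1)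
  · exact (((((k 3).mul hy0).mul (hy1.pow 2)).sub
      (ha.mul (((((k 2).mul hy0).mul hy1).mul hz1).add ((hy1.pow 2).mul hz0)))).sub
      (((k 2).mul hb).mul ((hy0.mul (hz1.pow 2)).add ((((k 2).mul hy1).mul hz0).mul hz1)))).sub
      ((((k 3).mul hc).mul hz0).mul (hz1.pow 2))
  · exact (((hy1.pow 3).sub ((ha.mul (hy1.pow 2)).mul hz1)).sub
      (((((k 2).mul hb).mul hy1)).mul (hz1.pow 2))).sub (hc.mul (hz1.pow 3))

theorem fderiv_C2_apply (ψ : C2 → C3) (q v : C2) (k : Fin 3) :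
    fderiv ℂ ψ q v k = fderiv ℂ ψ q (Pi.single 0 1) k * v 0 + fderiv ℂ ψ q (Pi.single 1 1) k * v 1 := by
  have h : v = v 0 • Pi.single 0 1 + v 1 • Pi.single 1 1 := by
    ext j; fin_cases j <;> simp
  conv_lhs => rw [h]
  simp [mul_comm]

/-- A nonzero tangent vector with vanishing `y` and `z` components would be a multiple of the unity.
Hence `(y, z)` are local coordinates on the surface. -/
theorem IsTransverseSurface.eq_zero {M : FrobeniusGerm} {ψ : C2 → C3}
    (hψ : IsTransverseSurface M ψ) (he : M.unit 0 = ![1, 0, 0]) {v : C2}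
    (h1 : fderiv ℂ ψ 0 v 1 = 0) (h2 : fderiv ℂ ψ 0 v 2 = 0) : v = 0 := by
  obtain ⟨-, -, hinj, ht⟩ := hψ
  refine hinj ?_
  rw [map_zero]
  by_contra hne
  have h0 : fderiv ℂ ψ 0 v 0 ≠ 0 := by
    intro h0
    exact hne (by ext k; fin_cases k <;> assumption)
  refine ht ((fderiv ℂ ψ 0 v 0)⁻¹ • v) ?_
  rw [he, map_smul]
  ext k; fin_cases k <;> simp [h0, h1, h2]

/-- The booklet web of `chazyGerm` in the parameters of a surface. -/
noncomputable def chazyBooklet (h A B : ℂ → ℂ) (ψ : C2 → C3) : CubicForm :=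
  pullCubic (fun q => ψ q 1 ^ 1 * (24 * h (ψ q 2))) (fun q => ψ q 1 ^ 2 * (12 * chazy₁ h A (ψ q 2)))
    (fun q => ψ q 1 ^ 3 * (4 * chazy₂ h A B (ψ q 2)))
    (fun q j => fderiv ℂ ψ q (Pi.single j 1) 1) (fun q j => fderiv ℂ ψ q (Pi.single j 1) 2)

theorem eval_chazyBooklet (h A B : ℂ → ℂ) (ψ : C2 → C3) (q v : C2) :
    (chazyBooklet h A B ψ).eval q v = fderiv ℂ ψ q v 1 ^ 3
      - ψ q 1 ^ 1 * (24 * h (ψ q 2)) * fderiv ℂ ψ q v 1 ^ 2 * fderiv ℂ ψ q v 2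
      - 2 * (ψ q 1 ^ 2 * (12 * chazy₁ h A (ψ q 2))) * fderiv ℂ ψ q v 1 * fderiv ℂ ψ q v 2 ^ 2
      - ψ q 1 ^ 3 * (4 * chazy₂ h A B (ψ q 2)) * fderiv ℂ ψ q v 2 ^ 3 := by
  rw [chazyBooklet, eval_pullCubic, ← fderiv_C2_apply, ← fderiv_C2_apply]

theorem analyticAt_component {m k : ℕ} {ψ : (Fin m → ℂ) → Fin k → ℂ} {q : Fin m → ℂ}
    (hψ : AnalyticAt ℂ ψ q) (j : Fin k) : AnalyticAt ℂ (fun q => ψ q j) q :=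
  AnalyticAt.fun_comp (g := fun p : Fin k → ℂ => p j) (analyticAt_coord j _) hψ

/-- At the base point `y = 0`, so the extreme coefficients are the cubes of the partial derivatives
of `y` along the surface, which cannot both vanish. -/
theorem isWebGerm_chazyBooklet {α β h A B S n : ℂ → ℂ} (H : IsWebPotential α β h A B S n)
    {ψ : C2 → C3} (hψ : IsTransverseSurface (chazyGerm H) ψ) :
    IsWebGerm (chazyBooklet h A B ψ) := by
  have hψ' := hψ
  obtain ⟨hψa, hψ0, hinj, ht⟩ := hψ
  have h1 := analyticAt_component hψa 1
  have hc : ∀ {F : ℂ → ℂ}, AnalyticAt ℂ F 0 → AnalyticAt ℂ (fun q => F (ψ q 2)) 0 := by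
    intro F hF
    exact AnalyticAt.fun_comp (g := F) (by simpa [hψ0] using hF) (analyticAt_component hψa 2)
  have hh := hc H.h_analytic
  have hA := hc H.A_analytic
  have hB := hc H.B_analytic
  have h₁ : AnalyticAt ℂ (fun q => chazy₁ h A (ψ q 2)) 0 :=
    hA.neg.div_const.sub (analyticAt_const.mul (hh.pow 2))
  have h₂ : AnalyticAt ℂ (fun q => chazy₂ h A B (ψ q 2)) 0 :=
    (hB.neg.div_const.add ((analyticAt_const.mul hh).mul hA)).add (analyticAt_const.mul (hh.pow 3))
  have hd : ∀ j k, AnalyticAt ℂ (fun q => fderiv ℂ ψ q (Pi.single j 1) k) 0 := fun j k =>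
    analyticAt_component
    (((ContinuousLinearMap.apply ℂ C3 (Pi.single j 1 : C2)).analyticAt _).comp hψa.fderiv) k
  refine ⟨analyticAt_pullCubic ((h1.pow 1).mul (analyticAt_const.mul hh))
    ((h1.pow 2).mul (analyticAt_const.mul h₁)) ((h1.pow 3).mul (analyticAt_const.mul h₂))
    (fun j => hd j 1) (fun j => hd j 2), ?_⟩
  by_contra! hall
  have e0 := hall 0
  have e3 := hall 3
  simp [chazyBooklet, pullCubic, hψ0] at e0 e3
  -- By construction `dz` vanishes on `v`; if `dy = 0`, transversality gives `v = 0`, so `dz = 0` as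
  -- well.
  set v : C2 := ![fderiv ℂ ψ 0 (Pi.single 1 1) 2, -fderiv ℂ ψ 0 (Pi.single 0 1) 2] with hv
  have hz : v = 0 := by
    refine hψ'.eq_zero rfl ?_ ?_
    · rw [fderiv_C2_apply, e0, e3]; simp
    · rw [fderiv_C2_apply, hv]; simp; ring
  have hz0 := congrFun hz 0
  have hz1 := congrFun hz 1
  simp [v] at hz0 hz1
  have := hψ'.eq_zero (v := Pi.single 0 1) rfl e0 hz1
  simpa using congrFun this 0

theorem hasFDerivAt_component {m k : ℕ} {ψ : (Fin m → ℂ) → Fin k → ℂ} {q : Fin m → ℂ}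
    (hψ : DifferentiableAt ℂ ψ q) (j : Fin k) :
    HasFDerivAt (fun q => ψ q j)
      ((ContinuousLinearMap.proj (R := ℂ) (φ := fun _ : Fin k => ℂ) j).comp (fderiv ℂ ψ q)) q :=
  hasFDerivAt_pi'.1 hψ.hasFDerivAt j

theorem IsTransverseSurface.tendsto {M : FrobeniusGerm} {ψ : C2 → C3}
    (hψ : IsTransverseSurface M ψ) (k : Fin 3) : Tendsto (fun q => ψ q k) (𝓝 0) (𝓝 0) := by
  have h := (analyticAt_component hψ.1 k).continuousAt
  simpa [ContinuousAt, hψ.2.1] using h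

theorem eventually_discr_ne {α β h A B S n : ℂ → ℂ} (H : IsWebPotential α β h A B S n)
    (hd : 4 * A 0 ^ 3 + 27 * B 0 ^ 2 ≠ 0) :
    ∀ᶠ z in 𝓝 (0 : ℂ), 4 * A z ^ 3 + 27 * B z ^ 2 ≠ 0 :=
  ((continuousAt_const.mul (H.A_analytic.continuousAt.pow 3)).add
    (continuousAt_const.mul (H.B_analytic.continuousAt.pow 2))).eventually_ne hd

/-- Semisimplicity can fail near the origin only where `y = 0`, and `y` has nonzero differential on
the surface, so it vanishes on no open set. -/
theorem isBookletWeb_chazyBooklet {α β h A B S n : ℂ → ℂ} (H : IsWebPotential α β h A B S n)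
    (hd : 4 * A 0 ^ 3 + 27 * B 0 ^ 2 ≠ 0)
    {ψ : C2 → C3} (hψ : IsTransverseSurface (chazyGerm H) ψ) :
    IsBookletWeb (chazyGerm H) ψ (chazyBooklet h A B ψ) := by
  refine ⟨isWebGerm_chazyBooklet H hψ, ?_⟩
  have hfd : fderiv ℂ (fun q => ψ q 1) 0 ≠ 0 := by
    intro h0
    rw [(hasFDerivAt_component hψ.1.differentiableAt 1).fderiv] at h0
    have hv : ∀ v, fderiv ℂ ψ 0 v 1 = 0 := fun v => congrArg (fun L : C2 →L[ℂ] ℂ => L v) h0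
    set v : C2 := ![fderiv ℂ ψ 0 (Pi.single 1 1) 2, -fderiv ℂ ψ 0 (Pi.single 0 1) 2] with hvd
    have hz : v = 0 := by
      refine hψ.eq_zero rfl (hv v) ?_
      rw [fderiv_C2_apply, hvd]; simp; ring
    have hz1 := congrFun hz 1
    simp [v] at hz1
    simpa using congrFun (hψ.eq_zero (v := Pi.single 0 1) rfl (hv _) hz1) 0
  have hfd' : ∀ᶠ q in 𝓝 (0 : C2), fderiv ℂ (fun q => ψ q 1) q ≠ 0 :=
    (analyticAt_component hψ.1 1).fderiv.continuousAt.eventually_ne hfd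
  filter_upwards [hfd', ((hψ.tendsto 2).eventually (eventually_discr_ne H hd)).eventually_nhds]
    with q h1 h2
  constructor
  · by_contra hcl
    rw [mem_closure_iff_frequently, not_frequently] at hcl
    refine h1 ?_
    have : (fun q => ψ q 1) =ᶠ[𝓝 q] fun _ => 0 := by
      filter_upwards [hcl, h2] with q' ha hb
      by_contra hne
      exact ha (isSemisimpleAt_chazyGerm H hne hb)
    rw [this.fderiv_eq]
    simp
  · intro ε hε v
    rw [eval_chazyBooklet]
    exact cubic_eq_zero_iff_mem_span hε.1 hε.2 (fderiv ℂ ψ q v)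

/-- Since `n' = -8hn`, the differential of `n(z)y` is `n(dy - 8hy dz)`: the second coordinate
completes the cube, and the factor between the forms is `n³`. -/
theorem webDiffeomorphic_chazyBooklet {α β h A B S n : ℂ → ℂ}
    (H : IsWebPotential α β h A B S n) {ψ : C2 → C3}
    (hψ : IsTransverseSurface (chazyGerm H) ψ) :
    WebDiffeomorphic (chazyBooklet h A B ψ)
      (monicCubic (fun _ => 0) (fun q => α (q 0) * q 1 ^ 2) (fun q => β (q 0) * q 1 ^ 3)) := by
  have hc : ∀ {F : ℂ → ℂ}, AnalyticAt ℂ F 0 → AnalyticAt ℂ (fun q => F (ψ q 2)) 0 := by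
    intro F hF
    exact AnalyticAt.fun_comp (g := F) (by simpa [hψ.2.1] using hF) (analyticAt_component hψ.1 2)
  set Φ : C2 → C2 := fun q => ![S (ψ q 2), n (ψ q 2) * ψ q 1] with hΦ
  have hΦa : AnalyticAt ℂ Φ 0 := by
    refine AnalyticAt.pi fun j => ?_
    fin_cases j
    · exact hc H.S_analytic
    · exact (hc H.n_analytic).mul (analyticAt_component hψ.1 1)
  have hder : ∀ᶠ q in 𝓝 (0 : C2), ∀ v, fderiv ℂ Φ q v 0 = deriv S (ψ q 2) * fderiv ℂ ψ q v 2 ∧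
      fderiv ℂ Φ q v 1 =
        n (ψ q 2) * (fderiv ℂ ψ q v 1 - 8 * h (ψ q 2) * ψ q 1 * fderiv ℂ ψ q v 2) := by
    filter_upwards [hΦa.eventually_analyticAt, hψ.1.eventually_analyticAt,
      (hψ.tendsto 2).eventually H.S_analytic.eventually_analyticAt,
      (hψ.tendsto 2).eventually H.n_deriv] with q h1 h2 h3 h4 v
    have e1 := hasFDerivAt_component h1.differentiableAt 0
    have e2 := hasFDerivAt_component h1.differentiableAt 1
    have d1 := hasFDerivAt_component h2.differentiableAt 1
    have d2 := hasFDerivAt_component h2.differentiableAt 2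
    have f1 := h3.differentiableAt.hasDerivAt.comp_hasFDerivAt q d2
    have f2 := (h4.comp_hasFDerivAt q d2).mul d1
    constructor
    · exact congrArg (fun L : C2 →L[ℂ] ℂ => L v) (e1.unique f1)
    · refine (congrArg (fun L : C2 →L[ℂ] ℂ => L v) (e2.unique f2)).trans ?_
      simp
      ring
  have hψ2 : ψ 0 2 = 0 := by rw [hψ.2.1]; rfl
  have hψ1 : ψ 0 1 = 0 := by rw [hψ.2.1]; rfl
  refine ⟨Φ, hΦa, ?_, ?_, fun q => n (ψ q 2) ^ 3, (hc H.n_analytic).pow 3, ?_, ?_⟩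
  · ext j; fin_cases j <;> simp [Φ, hψ2, hψ1, H.S_zero]
  · have hinj : Function.Injective (fderiv ℂ Φ 0 : C2 →ₗ[ℂ] C2) := by
      rw [← LinearMap.ker_eq_bot, LinearMap.ker_eq_bot']
      intro v hv
      obtain ⟨a1, a2⟩ := hder.self_of_nhds v
      have b1 := congrFun hv 0
      have b2 := congrFun hv 1
      simp only [ContinuousLinearMap.coe_coe, Pi.zero_apply] at b1 b2
      rw [a1, hψ2] at b1
      have c1 := (mul_eq_zero.1 b1).resolve_left H.S_deriv_ne
      rw [a2, hψ2, c1, mul_zero, sub_zero] at b2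
      exact hψ.eq_zero rfl ((mul_eq_zero.1 b2).resolve_left H.n_ne) c1
    exact ⟨hinj, LinearMap.surjective_of_injective hinj⟩
  · simpa [hψ2] using H.n_ne
  · filter_upwards [hder, (hψ.tendsto 2).eventually H.A_eq, (hψ.tendsto 2).eventually H.B_eq]
      with q h1 h2 h3 v
    obtain ⟨a1, a2⟩ := h1 v
    rw [eval_monicCubic, eval_chazyBooklet, a1, a2]
    simp only [Φ, Matrix.cons_val, chazy₁, chazy₂, h2, h3]
    ring

/-! ### Equivalences between the germs -/

theorem eventually_eq_of_eventually_fderiv_eq_zero {E F : Type*} [NormedAddCommGroup E]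
    [NormedSpace ℂ E] [NormedAddCommGroup F] [NormedSpace ℂ F] {f : E → F} {x : E}
    (hf : ∀ᶠ p in 𝓝 x, DifferentiableAt ℂ f p) (h : ∀ᶠ p in 𝓝 x, fderiv ℂ f p = 0) :
    ∀ᶠ p in 𝓝 x, f p = f x := by
  obtain ⟨r, hr, hb⟩ := Metric.eventually_nhds_iff_ball.1 (hf.and h)
  filter_upwards [Metric.ball_mem_nhds x hr] with p hp
  let _ : NormedSpace ℝ E := NormedSpace.restrictScalars ℝ ℂ E
  exact Metric.isOpen_ball.is_const_of_fderiv_eq_zero (convex_ball x r).isPreconnected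
    (fun q hq => (hb q hq).1.differentiableWithinAt) (fun q hq => (hb q hq).2) hp
    (Metric.mem_ball_self hr)

theorem eq_zero_of_pairing {u : C3} (h : ∀ v, pairing antiMetric u v = 0) : u = 0 := by
  have h0 := h ![0, 0, 1]
  have h1 := h ![0, 1, 0]
  have h2 := h ![1, 0, 0]
  simp [pairing_antiMetric] at h0 h1 h2
  ext k; fin_cases k <;> assumption

/-- A local homothety of the flat metric is linear. -/
theorem eventually_eq_linear_of_homothety {φ : C3 → C3} (hφ : AnalyticAt ℂ φ 0) (h0 : φ 0 = 0)
    {c : ℂ} (hc : c ≠ 0)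
    (hm : ∀ᶠ p in 𝓝 (0 : C3), ∀ u v, pairing antiMetric (fderiv ℂ φ p u) (fderiv ℂ φ p v) =
      c ^ 2 * pairing antiMetric u v) :
    (∀ᶠ p in 𝓝 (0 : C3), fderiv ℂ φ p = fderiv ℂ φ 0) ∧
      ∀ᶠ p in 𝓝 (0 : C3), φ p = fderiv ℂ φ 0 p := by
  have hD : ∀ᶠ p in 𝓝 (0 : C3), fderiv ℂ (fderiv ℂ φ) p = 0 := by
    filter_upwards [hφ.eventually_analyticAt, hm.eventually_nhds] with p hp hmp
    set D := fderiv ℂ φ p with hDdef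
    set D₂ := fderiv ℂ (fderiv ℂ φ) p with hD₂
    have hsymm : ∀ u w, D₂ u w = D₂ w u := fun u w =>
      (ContDiffAt.isSymmSndFDerivAt_of_omega hp.contDiffAt).eq u w
    have hd := hp.fderiv.differentiableAt.hasFDerivAt
    have hcomp : ∀ (u : C3) (k : Fin 3), HasFDerivAt (fun q => fderiv ℂ φ q u k)
        (((ContinuousLinearMap.proj (R := ℂ) (φ := fun _ : Fin 3 => ℂ) k).comp
          (ContinuousLinearMap.apply ℂ C3 u)).comp D₂) p := fun u k =>
      HasFDerivAt.comp p (((ContinuousLinearMap.proj (R := ℂ) (φ := fun _ : Fin 3 => ℂ) k).comp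
          (ContinuousLinearMap.apply ℂ C3 u)).hasFDerivAt) hd
    have hskew : ∀ w u v, pairing antiMetric (D₂ w u) (D v) =
        -pairing antiMetric (D₂ w v) (D u) := by
      intro w u v
      have e := (((hcomp u 0).mul (hcomp v 2)).add ((hcomp u 1).mul (hcomp v 1))).add
        ((hcomp u 2).mul (hcomp v 0))
      have e' : HasFDerivAt (fun _ : C3 => c ^ 2 * pairing antiMetric u v) _ p :=
        e.congr_of_eventuallyEq (hmp.mono fun q hq => by
          rw [← hq u v, pairing_antiMetric]; rfl)
      have e2 := congrArg (fun L : C3 →L[ℂ] ℂ => L w) (e'.unique (hasFDerivAt_const _ p))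
      simp at e2
      rw [pairing_antiMetric, pairing_antiMetric]
      linear_combination e2
    -- The trilinear form is skew in `u`, `v` and symmetric in `w`, `u`, hence zero. This is the
    -- argument for uniqueness of the Levi-Civita connection.
    have hT : ∀ w u v, pairing antiMetric (D₂ w u) (D v) = 0 := by
      intro w u v
      have a1 := hskew w u v
      have a2 := hskew v w u
      have a3 := hskew u v w
      rw [hsymm v w] at a2
      rw [hsymm u v, hsymm u w] at a3
      linear_combination (1 / 2) * a1 - (1 / 2) * a2 + (1 / 2) * a3
    have hinj : Function.Injective (D : C3 →ₗ[ℂ] C3) := by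
      rw [← LinearMap.ker_eq_bot, LinearMap.ker_eq_bot']
      intro u hu
      refine eq_zero_of_pairing fun v => ?_
      have e := hmp.self_of_nhds u v
      have hu' : fderiv ℂ φ p u = 0 := hu
      rw [hu', pairing_antiMetric 0] at e
      simpa [hc] using e
    have hsurj := LinearMap.surjective_of_injective hinj
    ext1 w
    ext1 u
    refine eq_zero_of_pairing fun x => ?_
    obtain ⟨v, rfl⟩ := hsurj x
    exact hT w u v
  have h1 := eventually_eq_of_eventually_fderiv_eq_zero
    (hφ.fderiv.eventually_analyticAt.mono fun p hp => hp.differentiableAt) hD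
  refine ⟨h1, ?_⟩
  have h2 := eventually_eq_of_eventually_fderiv_eq_zero (x := (0 : C3))
    (f := fun p => φ p - fderiv ℂ φ 0 p)
    (hφ.eventually_analyticAt.mono fun p hp =>
      hp.differentiableAt.sub (fderiv ℂ φ 0).differentiableAt) (by
    filter_upwards [h1, hφ.eventually_analyticAt] with p hp hpa
    rw [fderiv_fun_sub hpa.differentiableAt (fderiv ℂ φ 0).differentiableAt,
      ContinuousLinearMap.fderiv, hp, sub_self])
  filter_upwards [h2] with p hp
  simpa [h0, sub_eq_zero] using hp

/-- A linear equivalence of two germs rescales the solution of Chazy's equation. -/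
theorem exists_scaling_of_linear {h A B h' A' B' : ℂ → ℂ} {L : C3 →L[ℂ] C3} {c : ℂ} (hc : c ≠ 0)
    (hL : Function.Surjective L)
    (hm : ∀ u v, pairing antiMetric (L u) (L v) = c ^ 2 * pairing antiMetric u v)
    (hmul : ∀ᶠ p in 𝓝 (0 : C3), ∀ u v, L (tangentMul (chazyMul h A B p) u v) =
      tangentMul (chazyMul h' A' B' (L p)) (L u) (L v)) :
    ∃ s : ℂ, s ≠ 0 ∧ h 0 = s ^ 2 * h' 0 ∧ chazy₁ h A 0 = s ^ 4 * chazy₁ h' A' 0 ∧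
      chazy₂ h A B 0 = s ^ 6 * chazy₂ h' A' B' 0 := by
  set s := L ![0, 1, 0] 1 with hs
  have hmul0 := hmul.self_of_nhds
  simp only [map_zero, chazyMul, tangentMul_cubicAlgebra, Pi.zero_apply] at hmul0
  simp only [ne_eq, OfNat.ofNat_ne_zero, one_ne_zero, not_false_eq_true, zero_pow, zero_mul,
    add_zero] at hmul0
  have hL0 : L ![1, 0, 0] = ![1, 0, 0] := by
    obtain ⟨v, hv⟩ := hL ![1, 0, 0]
    have e := hmul0 ![1, 0, 0] v
    have e1 : (![![1, 0, 0] 0 * v 0, ![1, 0, 0] 0 * v 1 + ![1, 0, 0] 1 * v 0,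
        ![1, 0, 0] 0 * v 2 + ![1, 0, 0] 2 * v 0 + ![1, 0, 0] 1 * v 1] : C3) = v := by
      ext k; fin_cases k <;> simp
    rw [e1, hv] at e
    refine (e.trans ?_).symm
    ext k; fin_cases k <;> simp
  have hL2 : ∀ w, L w 2 = c ^ 2 * w 2 := by
    intro w
    have e := hm ![1, 0, 0] w
    rw [hL0] at e
    simpa [pairing_antiMetric] using e
  have h12 : L ![0, 1, 0] 2 = 0 := by rw [hL2]; simp
  have hsc : s ^ 2 = c ^ 2 := by
    have e := hm ![0, 1, 0] ![0, 1, 0]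
    rw [pairing_antiMetric, pairing_antiMetric, h12, ← hs] at e
    simp at e
    linear_combination e
  have hs0 : s ≠ 0 := by
    intro h0
    rw [h0] at hsc
    exact hc (by simpa using hsc.symm)
  -- At the origin the algebra is `ℂ[u]/(u³)`. So `L u` has cube zero, which kills its component
  -- along the unity, and `L` is determined on `u²`.
  have e11 := hmul0 ![0, 1, 0] ![0, 1, 0]
  have e12 := hmul0 ![0, 1, 0] ![0, 0, 1]
  simp [h12] at e11 e12
  rw [e11] at e12
  have hμ : L ![0, 1, 0] 0 = 0 := by
    have h3 : L (![0, 0, 0] : C3) = 0 := by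
      rw [← map_zero L]; congr 1; ext k; fin_cases k <;> rfl
    rw [h3] at e12
    have := congrFun e12 0
    simpa using this
  have hL1 : L ![0, 1, 0] = ![0, s, 0] := by
    ext k; fin_cases k
    · exact hμ
    · rfl
    · exact h12
  have hLe2 : L ![0, 0, 1] = ![0, 0, s ^ 2] := by
    rw [e11, hL1]
    ext k; fin_cases k <;> simp
    ring
  have hLv : ∀ x y z : ℂ, L ![x, y, z] = ![x, s * y, s ^ 2 * z] := by
    intro x y z
    have : (![x, y, z] : C3) = x • ![1, 0, 0] + y • ![0, 1, 0] + z • ![0, 0, 1] := by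
      ext k; fin_cases k <;> simp
    rw [this, map_add, map_add, map_smul, map_smul, map_smul, hL0, hL1, hLe2]
    ext k; fin_cases k <;> simp <;> ring
  -- The functions `h`, `chazy₁`, `chazy₂` are invisible at the origin, where they are multiplied by
  -- powers of `y`; they are compared at a point `(0, y, 0)` with `y ≠ 0`.
  have hcurve : Tendsto (fun y : ℂ => (![0, y, 0] : C3)) (𝓝 0) (𝓝 0) := by
    have hcont : Continuous (fun y : ℂ => (![0, y, 0] : C3)) := by fun_prop
    have h0 : (![0, 0, 0] : C3) = 0 := by ext k; fin_cases k <;> rfl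
    simpa [h0] using hcont.tendsto 0
  obtain ⟨y, hy, hy0⟩ := (((hcurve.eventually hmul).filter_mono nhdsWithin_le_nhds).and
    (self_mem_nhdsWithin : {0}ᶜ ∈ 𝓝[≠] (0 : ℂ))).exists
  have hy0 : y ≠ 0 := hy0
  have g11 := hy ![0, 1, 0] ![0, 1, 0]
  have g12 := hy ![0, 1, 0] ![0, 0, 1]
  simp only [chazyMul, tangentMul_cubicAlgebra, hLv] at g11 g12
  simp at g11 g12
  refine ⟨s, hs0, ?_, ?_, ?_⟩
  · refine mul_left_cancel₀ (mul_ne_zero (mul_ne_zero hs0 hy0) (by norm_num : (24 : ℂ) ≠ 0)) ?_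
    linear_combination g11.2.1
  · refine mul_left_cancel₀ (mul_ne_zero (pow_ne_zero 2 hy0) (by norm_num : (12 : ℂ) ≠ 0)) ?_
    linear_combination g11.1
  · refine mul_left_cancel₀ (mul_ne_zero (pow_ne_zero 3 hy0) (by norm_num : (4 : ℂ) ≠ 0)) ?_
    linear_combination g12.1

/-- Equivalent germs come from rescaled solutions of Chazy's equation. -/
theorem exists_scaling_of_equivalent {α β h A B S n α' β' h' A' B' S' n' : ℂ → ℂ}
    (H : IsWebPotential α β h A B S n) (H' : IsWebPotential α' β' h' A' B' S' n')
    (he : (chazyGerm H).Equivalent (chazyGerm H')) :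
    ∃ t : ℂ, t ≠ 0 ∧ h 0 = t * h' 0 ∧ A 0 = t ^ 2 * A' 0 ∧ B 0 = t ^ 3 * B' 0 := by
  obtain ⟨φ, hφ, hφ0, hbij, c, hc, hcond⟩ := he
  obtain ⟨h1, h2⟩ := eventually_eq_linear_of_homothety hφ hφ0 hc
    (hcond.mono fun p hp u v => (hp u v).1)
  obtain ⟨s, hs, e0, e1, e2⟩ := exists_scaling_of_linear (L := fderiv ℂ φ 0) (h := h) (A := A)
    (B := B) (h' := h') (A' := A') (B' := B') hc hbij.2
    (fun u v => (hcond.self_of_nhds u v).1) (by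
      filter_upwards [h1, h2, hcond] with p hp hp' hcp u v
      have e := (hcp u v).2
      rwa [hp, hp'] at e)
  simp only [chazy₁, chazy₂] at e1 e2
  have eA : A 0 = s ^ 4 * A' 0 := by
    rw [e0] at e1
    linear_combination -24 * e1
  refine ⟨s ^ 2, pow_ne_zero 2 hs, e0, by rw [eA]; ring, ?_⟩
  rw [e0, eA] at e2
  linear_combination -4 * e2

/-! ### The family of germs -/

theorem IsWebPotential.discr_ne {α β h A B S n : ℂ → ℂ} (H : IsWebPotential α β h A B S n)
    (hd : 4 * α 0 ^ 3 + 27 * β 0 ^ 2 ≠ 0) : 4 * A 0 ^ 3 + 27 * B 0 ^ 2 ≠ 0 := by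
  rw [H.A_eq.self_of_nhds, H.B_eq.self_of_nhds, H.S_zero]
  have : 4 * (α 0 * deriv S 0 ^ 2) ^ 3 + 27 * (β 0 * deriv S 0 ^ 3) ^ 2 =
      deriv S 0 ^ 6 * (4 * α 0 ^ 3 + 27 * β 0 ^ 2) := by ring
  rw [this]
  exact mul_ne_zero (pow_ne_zero 6 H.S_deriv_ne) hd

theorem isMassive_chazyGerm {α β h A B S n : ℂ → ℂ} (H : IsWebPotential α β h A B S n)
    (hd : 4 * A 0 ^ 3 + 27 * B 0 ^ 2 ≠ 0) : (chazyGerm H).IsMassive := by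
  have hcurve : Tendsto (fun y : ℂ => (![0, y, 0] : C3)) (𝓝[≠] 0) (𝓝 0) := by
    have hcont : Continuous (fun y : ℂ => (![0, y, 0] : C3)) := by fun_prop
    have h0 : (![0, 0, 0] : C3) = 0 := by ext k; fin_cases k <;> rfl
    have := (hcont.tendsto 0).mono_left (nhdsWithin_le_nhds (s := {0}ᶜ))
    rwa [h0] at this
  refine hcurve.frequently (Eventually.frequently ?_)
  filter_upwards [self_mem_nhdsWithin] with y hy
  exact isSemisimpleAt_chazyGerm H hy hd

theorem hasNullUnit_chazyGerm {α β h A B S n : ℂ → ℂ} (H : IsWebPotential α β h A B S n) :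
    (chazyGerm H).HasNullUnit :=
  Eventually.of_forall fun p => by
    change pairing antiMetric ![1, 0, 0] ![1, 0, 0] = 0
    simp [pairing_antiMetric]

/-- The Möbius family of germs, parametrized by the value of the solution at the origin. -/
noncomputable def chazyFamily {α β h A B S n : ℂ → ℂ} (H : IsWebPotential α β h A B S n) (τ : ℂ) :
    FrobeniusGerm :=
  chazyGerm (H.moebius (8 * (τ - h 0)))

theorem isHolomorphicFamily_chazyFamily {α β h A B S n : ℂ → ℂ}
    (H : IsWebPotential α β h A B S n) (T : Set ℂ) :
    FrobeniusGerm.IsHolomorphicFamily T (chazyFamily H) := by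
  intro τ _
  have hc : ∀ k : Fin 3, AnalyticAt ℂ (fun q : ℂ × C3 => q.2 k) (τ, 0) := fun k =>
    AnalyticAt.fun_comp (g := fun p : C3 => p k) (analyticAt_coord k _) analyticAt_snd
  have ht : AnalyticAt ℂ (fun q : ℂ × C3 => 8 * (q.1 - h 0)) (τ, 0) :=
    analyticAt_const.mul (analyticAt_fst.sub analyticAt_const)
  refine ⟨fun i j => analyticAt_const, fun i j k => ?_, fun i => analyticAt_const, fun i => ?_⟩
  · exact analyticAt_chazyMul (h := fun q : ℂ × C3 => moebiusChazy h (8 * (q.1 - h 0)))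
      (A := fun q => moebiusPull 4 A (8 * (q.1 - h 0)))
      (B := fun q => moebiusPull 6 B (8 * (q.1 - h 0))) (p := fun q => q.2)
      (analyticAt_moebiusChazy H.h_analytic ht (hc 2) rfl)
      (analyticAt_moebiusPull H.A_analytic 4 ht (hc 2) rfl)
      (analyticAt_moebiusPull H.B_analytic 6 ht (hc 2) rfl) (hc 1) i j k
  · fin_cases i
    · exact analyticAt_const.mul (hc 0)
    · exact hc 1
    · exact analyticAt_const

theorem not_equivalent_chazyFamily {α β h A B S n : ℂ → ℂ} (H : IsWebPotential α β h A B S n)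
    (hd : 4 * A 0 ^ 3 + 27 * B 0 ^ 2 ≠ 0) {τ σ : ℂ} (hτ : τ ∈ Metric.ball (1 : ℂ) (1 / 4))
    (hσ : σ ∈ Metric.ball (1 : ℂ) (1 / 4)) (hne : τ ≠ σ) :
    ¬ (chazyFamily H τ).Equivalent (chazyFamily H σ) := by
  intro he
  obtain ⟨t, ht, e0, eA, eB⟩ := exists_scaling_of_equivalent _ _ he
  simp only [moebiusPull_zero_right, moebiusChazy_zero_right] at e0 eA eB
  -- The Möbius parameter `8(τ - h 0)` was chosen so that the transformed `h` has the value `τ` at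
  -- the origin.
  have e0 : τ = t * σ := by linear_combination e0
  rw [Metric.mem_ball, Complex.dist_eq] at hτ hσ
  have ht1 : t - 1 ≠ 0 := by
    intro h1
    rw [sub_eq_zero.1 h1, one_mul] at e0
    exact hne e0
  set u := τ - 1 with hu
  set v := σ - 1 with hv
  have hσ0 : σ ≠ 0 := by
    intro h0
    rw [hv, h0] at hσ
    norm_num at hσ
  -- Since `A(0)` and `B(0)` are common to both germs, `t³ = 1` in the first case and `t² = 1` in
  -- the second. With `t ≠ 1`, the points `τ` and `tau/t = σ` cannot both be within `1/4` of `1`.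
  by_cases hA : A 0 = 0
  · have hB : B 0 ≠ 0 := by
      intro hB
      exact hd (by rw [hA, hB]; norm_num)
    have h3 : t ^ 2 + t + 1 = 0 := by
      have : (t ^ 3 - 1) * B 0 = 0 := by linear_combination -eB
      have h4 := (mul_eq_zero.1 this).resolve_right hB
      refine (mul_eq_zero.1 (?_ : (t - 1) * (t ^ 2 + t + 1) = 0)).resolve_left ht1
      linear_combination h4
    have h5 : (3 : ℂ) = -(3 * u + 3 * v + (u ^ 2 + u * v + v ^ 2)) := by
      have h6 : τ ^ 2 + τ * σ + σ ^ 2 = 0 := by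
        rw [e0]; linear_combination σ ^ 2 * h3
      rw [hu, hv]
      linear_combination h6
    have h7 : ‖(3 : ℂ)‖ ≤ 3 * ‖u‖ + 3 * ‖v‖ + (‖u‖ ^ 2 + ‖u‖ * ‖v‖ + ‖v‖ ^ 2) := by
      rw [h5, norm_neg]
      refine (norm_add_le _ _).trans (add_le_add ((norm_add_le _ _).trans (by simp)) ?_)
      refine (norm_add_le _ _).trans (add_le_add ((norm_add_le _ _).trans ?_) ?_) <;> simp
    norm_num at h7
    nlinarith [norm_nonneg u, norm_nonneg v]
  · have h3 : t + 1 = 0 := by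
      have : (t ^ 2 - 1) * A 0 = 0 := by linear_combination -eA
      have h4 := (mul_eq_zero.1 this).resolve_right hA
      refine (mul_eq_zero.1 (?_ : (t - 1) * (t + 1) = 0)).resolve_left ht1
      linear_combination h4
    have h5 : (2 : ℂ) = -(u + v) := by
      rw [hu, hv, e0]
      linear_combination σ * h3
    have h7 : ‖(2 : ℂ)‖ ≤ ‖u‖ + ‖v‖ := by
      rw [h5, norm_neg]
      exact norm_add_le _ _
    norm_num at h7
    linarith

/-- The family of Frobenius threefolds with a given booklet web, for a web that satisfies the
flatness equations. -/
theorem exists_family_of_flat {α β G : ℂ → ℂ} (hα : AnalyticAt ℂ α 0) (hβ : AnalyticAt ℂ β 0)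
    (hG : AnalyticAt ℂ G 0) (hα' : ∀ᶠ x in 𝓝 (0 : ℂ), HasDerivAt α (6 * β x - α x * G x) x)
    (hβ' : ∀ᶠ x in 𝓝 (0 : ℂ), HasDerivAt β (-(3 / 2) * G x * β x - 4 / 3 * α x ^ 2) x)
    (hd : 4 * α 0 ^ 3 + 27 * β 0 ^ 2 ≠ 0) {W : CubicForm}
    (hW : W = monicCubic (fun _ => 0) (fun q => α (q 0) * q 1 ^ 2)
      (fun q => β (q 0) * q 1 ^ 3)) :
    ∃ (T : Set ℂ) (F : ℂ → FrobeniusGerm),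
      IsOpen T ∧ IsConnected T ∧ FrobeniusGerm.IsHolomorphicFamily T F ∧
      (∀ τ ∈ T, (F τ).IsMassive ∧ (F τ).HasNullUnit ∧
        ∀ ψ : C2 → C3, IsTransverseSurface (F τ) ψ →
          ∃ K : CubicForm, IsBookletWeb (F τ) ψ K ∧ WebDiffeomorphic K W) ∧
      (∀ τ ∈ T, ∀ σ ∈ T, τ ≠ σ → ¬ (F τ).Equivalent (F σ)) := by
  obtain ⟨h, A, B, S, n, H⟩ := exists_isWebPotential hα hβ hG hα' hβ'
  subst hW
  refine ⟨Metric.ball 1 (1 / 4), chazyFamily H, Metric.isOpen_ball,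
    ⟨⟨1, Metric.mem_ball_self (by norm_num)⟩, (convex_ball _ _).isPreconnected⟩,
    isHolomorphicFamily_chazyFamily H _, fun τ _ => ?_, fun τ hτ σ hσ hne =>
      not_equivalent_chazyFamily H (H.discr_ne hd) hτ hσ hne⟩
  have hd' := (H.moebius (8 * (τ - h 0))).discr_ne hd
  exact ⟨isMassive_chazyGerm _ hd', hasNullUnit_chazyGerm _, fun ψ hψ =>
    ⟨_, isBookletWeb_chazyBooklet _ hd' hψ, webDiffeomorphic_chazyBooklet _ hψ⟩⟩

/-! ### The two webs -/

theorem sqrt_three_sq : ((Real.sqrt 3 : ℝ) : ℂ) ^ 2 = 3 := by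
  rw [← Complex.ofReal_pow, Real.sq_sqrt (by norm_num)]; norm_num

theorem sqrt_three_ne_zero : ((Real.sqrt 3 : ℝ) : ℂ) ≠ 0 := by
  intro h
  have := sqrt_three_sq
  rw [h] at this
  norm_num at this

theorem sqrt_twentySeven : ((Real.sqrt 27 : ℝ) : ℂ) = 3 * (Real.sqrt 3 : ℂ) := by
  have h : Real.sqrt 27 = 3 * Real.sqrt 3 := by
    rw [show (27 : ℝ) = 3 ^ 2 * 3 by norm_num, Real.sqrt_mul (by norm_num),
      Real.sqrt_sq (by norm_num)]
  rw [h]; push_cast; rfl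

theorem exists_family_webForm6 {L : ℂ} (hL : Complex.cos L ≠ 0) :
    ∃ (T : Set ℂ) (F : ℂ → FrobeniusGerm),
      IsOpen T ∧ IsConnected T ∧ FrobeniusGerm.IsHolomorphicFamily T F ∧
      (∀ τ ∈ T, (F τ).IsMassive ∧ (F τ).HasNullUnit ∧
        ∀ ψ : C2 → C3, IsTransverseSurface (F τ) ψ →
          ∃ K : CubicForm, IsBookletWeb (F τ) ψ K ∧ WebDiffeomorphic K (webForm6 L)) ∧
      (∀ τ ∈ T, ∀ σ ∈ T, τ ≠ σ → ¬ (F τ).Equivalent (F σ)) := by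
  set s : ℂ := (Real.sqrt 3 : ℂ) with hs
  have hs2 : s ^ 2 = 3 := sqrt_three_sq
  have hs0 : s ≠ 0 := sqrt_three_ne_zero
  set β : ℂ → ℂ := fun x => -(2 / (3 * s) * Complex.tan (2 * s * x + L)) with hβd
  have hcos : ∀ᶠ x in 𝓝 (0 : ℂ), Complex.cos (2 * s * x + L) ≠ 0 :=
    (by fun_prop : Continuous fun x : ℂ => Complex.cos (2 * s * x + L)).continuousAt.eventually_ne
      (by simpa using hL)
  have hder : ∀ᶠ x in 𝓝 (0 : ℂ), HasDerivAt β (-9 * β x ^ 2 - 4 / 3) x := by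
    filter_upwards [hcos] with x hx
    have h1 : HasDerivAt (fun x : ℂ => 2 * s * x + L) (2 * s * 1) x :=
      ((hasDerivAt_id' x).const_mul (2 * s)).add_const L
    have h2 := (((Complex.hasDerivAt_tan hx).comp x h1).const_mul (2 / (3 * s))).neg
    refine h2.congr_deriv ?_
    rw [hβd]
    simp only [Complex.tan_eq_sin_div_cos]
    have hsc := Complex.sin_sq_add_cos_sq (2 * s * x + L)
    field_simp
    rw [show Complex.sin (2 * s * x + L) ^ 2 = 1 - Complex.cos (2 * s * x + L) ^ 2 by
      linear_combination hsc, hs2]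
    ring
  have hβ : AnalyticAt ℂ β 0 := Complex.analyticAt_iff_eventually_differentiableAt.2
    (hder.mono fun x hx => hx.differentiableAt)
  -- With `α` constant, the first flatness equation forces `G = 6β`, and the second becomes the
  -- Riccati equation `hder`.
  refine exists_family_of_flat (α := fun _ => 1) (β := β) (G := fun x => 6 * β x)
    analyticAt_const hβ (analyticAt_const.mul hβ)
    (Eventually.of_forall fun x => (hasDerivAt_const x (1 : ℂ)).congr_deriv (by ring))
    (hder.mono fun x hx => hx.congr_deriv (by ring)) ?_ ?_
  · have hsc := Complex.sin_sq_add_cos_sq L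
    simp only [β, mul_zero, zero_add, Complex.tan_eq_sin_div_cos]
    have h4 : 4 * (1 : ℂ) ^ 3 + 27 * (-(2 / (3 * s) * (Complex.sin L / Complex.cos L))) ^ 2 =
        4 / Complex.cos L ^ 2 := by
      field_simp
      rw [hs2]
      linear_combination 108 * hsc
    rw [h4]
    exact div_ne_zero (by norm_num) (pow_ne_zero 2 hL)
  · simp only [webForm6, sqrt_twentySeven, ← hs, β]
    congr 1 <;> funext q <;> ring

/-! ### The web with the cotangent coefficient -/

/-- The entire functions `cos √w` and `sin √w / √w`, near the origin. -/
theorem exists_cos_sqrt_sin_sqrt : ∃ C S : ℂ → ℂ, AnalyticAt ℂ C 0 ∧ AnalyticAt ℂ S 0 ∧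
    S 0 = 1 ∧ ∀ᶠ θ in 𝓝 (0 : ℂ),
      Complex.cos θ = C (θ ^ 2) ∧ Complex.sin θ = θ * S (θ ^ 2) := by
  have hb : ∀ m : ℕ → ℕ, ∀ n : ℕ, ‖(-1 : ℂ) ^ n / (m n).factorial‖ ≤ 1 * 1 ^ n := by
    intro m n
    rw [norm_div, norm_pow, norm_neg, norm_one, one_pow, mul_one, RCLike.norm_natCast,
      div_le_one (by exact_mod_cast Nat.factorial_pos _)]
    exact_mod_cast Nat.factorial_pos _
  obtain ⟨C, hC⟩ := exists_hasFPowerSeriesAt one_pos (hb fun n => 2 * n)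
  obtain ⟨S, hS⟩ := exists_hasFPowerSeriesAt one_pos (hb fun n => 2 * n + 1)
  have hsq : Tendsto (fun θ : ℂ => θ ^ 2) (𝓝 0) (𝓝 0) := by
    simpa using (continuous_pow 2 : Continuous fun θ : ℂ => θ ^ 2).tendsto 0
  refine ⟨C, S, hC.analyticAt, hS.analyticAt, ?_, ?_⟩
  · simpa using iteratedDeriv_eq_of_hasFPowerSeriesAt hS 0
  · have h1 := hsq.eventually hC.eventually_hasSum
    have h2 := hsq.eventually hS.eventually_hasSum
    simp only [FormalMultilinearSeries.ofScalars_apply_eq, smul_eq_mul, zero_add] at h1 h2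
    filter_upwards [h1, h2] with θ a b
    constructor
    · exact (Complex.hasSum_cos θ).unique (by simpa only [← pow_mul, div_mul_eq_mul_div] using a)
    · have e : (fun n : ℕ => (-1 : ℂ) ^ n * θ ^ (2 * n + 1) / ((2 * n + 1).factorial : ℂ)) =
          fun n : ℕ => θ * ((-1) ^ n / ((2 * n + 1).factorial : ℂ) * (θ ^ 2) ^ n) := by
        funext n
        rw [pow_succ θ, pow_mul]
        ring
      exact (Complex.hasSum_sin θ).unique (e ▸ b.mul_left θ)

theorem cpow_three_halves_sq (x : ℂ) : (x ^ (3 / 2 : ℂ)) ^ 2 = x ^ 3 := by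
  rw [← Complex.cpow_nat_mul]
  norm_num

theorem cpow_three_halves_ne_zero {x : ℂ} (hx : x ≠ 0) : x ^ (3 / 2 : ℂ) ≠ 0 := by
  intro h
  have := cpow_three_halves_sq x
  rw [h] at this
  exact pow_ne_zero 3 hx (by simpa using this.symm)

theorem tendsto_cpow_three_halves (c : ℂ) :
    Tendsto (fun x : ℂ => c * x ^ (3 / 2 : ℂ)) (𝓝 0) (𝓝 0) := by
  have h : ContinuousAt (fun x : ℂ => c * x ^ (3 / 2 : ℂ)) 0 :=
    continuousAt_const.mul (Complex.continuousAt_cpow_const_of_re_pos (Or.inl le_rfl) (by norm_num))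
  simpa [ContinuousAt] using h

/-- For `θ = (4/√3)x^(3/2)` one has `θ² = 16x³/3`, and `cos θ` and `sin θ / θ` are holomorphic in
`θ²`; the branch of the root drops out of the quotient. -/
theorem analyticAt_cotCoeff : AnalyticAt ℂ cotCoeff 0 ∧
    ∀ᶠ x in 𝓝[≠] (0 : ℂ), Complex.sin (4 / (Real.sqrt 3 : ℂ) * x ^ (3 / 2 : ℂ)) ≠ 0 := by
  set s : ℂ := (Real.sqrt 3 : ℂ) with hs
  have hs2 : s ^ 2 = 3 := sqrt_three_sq
  have hs0 : s ≠ 0 := sqrt_three_ne_zero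
  obtain ⟨C, S, hC, hS, hS0, hCS⟩ := exists_cos_sqrt_sin_sqrt
  have hC0 : C 0 = 1 := by simpa using hCS.self_of_nhds.1.symm
  have hcub : AnalyticAt ℂ (fun x : ℂ => 16 / 3 * x ^ 3) 0 := analyticAt_const.mul (analyticAt_id.pow 3)
  have hC' : AnalyticAt ℂ (fun x : ℂ => C (16 / 3 * x ^ 3)) 0 :=
    AnalyticAt.fun_comp (g := C) (by simpa using hC) hcub
  have hS' : AnalyticAt ℂ (fun x : ℂ => S (16 / 3 * x ^ 3)) 0 :=
    AnalyticAt.fun_comp (g := S) (by simpa using hS) hcub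
  have hSne : ∀ᶠ x in 𝓝 (0 : ℂ), S (16 / 3 * x ^ 3) ≠ 0 :=
    hS'.continuousAt.eventually_ne (by simp [hS0])
  have hθ := (tendsto_cpow_three_halves (4 / s)).eventually hCS
  have hsq : ∀ x : ℂ, (4 / s * x ^ (3 / 2 : ℂ)) ^ 2 = 16 / 3 * x ^ 3 := by
    intro x
    rw [mul_pow, cpow_three_halves_sq, div_pow, hs2]
    norm_num
  simp only [hsq] at hθ
  constructor
  · have hf : AnalyticAt ℂ (fun x : ℂ => C (16 / 3 * x ^ 3) / (4 / s * S (16 / 3 * x ^ 3))) 0 :=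
      hC'.div (analyticAt_const.mul hS') (by simp [hS0, hs0])
    refine hf.congr ?_
    filter_upwards [hθ, hSne] with x h1 h2
    by_cases hx : x = 0
    · simp [cotCoeff, hx, hC0, hS0, ← hs]
    · have hu := cpow_three_halves_ne_zero hx
      rw [cotCoeff, if_neg hx, ← hs, Complex.tan_eq_sin_div_cos, h1.1, h1.2]
      field_simp
  · filter_upwards [hθ.filter_mono nhdsWithin_le_nhds, hSne.filter_mono nhdsWithin_le_nhds,
      self_mem_nhdsWithin] with x h1 h2 hx
    rw [h1.2]
    exact mul_ne_zero (mul_ne_zero (div_ne_zero (by norm_num) hs0)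
      (cpow_three_halves_ne_zero hx)) h2

/-- The slit plane makes the principal power differentiable. The result involves the root `u =
x^(3/2)` only through `u² = x³`, so it can be continued across the slit. -/
theorem hasDerivAt_cotCoeff {x : ℂ} (hx : x ∈ Complex.slitPlane)
    (hsin : Complex.sin (4 / (Real.sqrt 3 : ℂ) * x ^ (3 / 2 : ℂ)) ≠ 0) :
    HasDerivAt cotCoeff ((3 / 2 * cotCoeff x
      - 6 / (Real.sqrt 3 : ℂ) * (x ^ 3 + cotCoeff x ^ 2)) / x) x := by
  have hs0 : (Real.sqrt 3 : ℂ) ≠ 0 := sqrt_three_ne_zero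
  set s : ℂ := (Real.sqrt 3 : ℂ)
  have hx0 : x ≠ 0 := Complex.slitPlane_ne_zero hx
  have heq : ∀ {z : ℂ}, z ≠ 0 → cotCoeff z = z ^ (3 / 2 : ℂ) *
      (Complex.cos (4 / s * z ^ (3 / 2 : ℂ)) / Complex.sin (4 / s * z ^ (3 / 2 : ℂ))) := by
    intro z hz
    rw [cotCoeff, if_neg hz, Complex.tan_eq_sin_div_cos, div_div_eq_mul_div, mul_div_assoc]
  have hu : HasDerivAt (fun z : ℂ => z ^ (3 / 2 : ℂ)) (3 / 2 * x ^ (3 / 2 : ℂ) / x) x := by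
    refine ((hasDerivAt_id' x).cpow_const hx).congr_deriv ?_
    rw [Complex.cpow_sub _ _ hx0, Complex.cpow_one]
    ring
  have hcu := hu.const_mul (4 / s)
  have hf := (hu.mul (hcu.ccos.div hcu.csin hsin)).congr_of_eventuallyEq
    (f₁ := cotCoeff) (by
      filter_upwards [isOpen_ne.mem_nhds hx0] with z hz using heq hz)
  refine hf.congr_deriv ?_
  rw [heq hx0, ← cpow_three_halves_sq]
  simp only [Pi.div_apply]
  generalize x ^ (3 / 2 : ℂ) = u at *
  have hsc := Complex.sin_sq_add_cos_sq (4 / s * u)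
  generalize Complex.sin (4 / s * u) = a at *
  generalize Complex.cos (4 / s * u) = b at *
  field_simp
  ring

theorem exists_family_webForm5 :
    ∃ (T : Set ℂ) (F : ℂ → FrobeniusGerm),
      IsOpen T ∧ IsConnected T ∧ FrobeniusGerm.IsHolomorphicFamily T F ∧
      (∀ τ ∈ T, (F τ).IsMassive ∧ (F τ).HasNullUnit ∧
        ∀ ψ : C2 → C3, IsTransverseSurface (F τ) ψ →
          ∃ K : CubicForm, IsBookletWeb (F τ) ψ K ∧ WebDiffeomorphic K webForm5) ∧
      (∀ τ ∈ T, ∀ σ ∈ T, τ ≠ σ → ¬ (F τ).Equivalent (F σ)) := by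
  obtain ⟨hcot, hsin⟩ := analyticAt_cotCoeff
  have hs2 : (Real.sqrt 3 : ℂ) ^ 2 = 3 := sqrt_three_sq
  have hs0 : (Real.sqrt 3 : ℂ) ≠ 0 := sqrt_three_ne_zero
  set s : ℂ := (Real.sqrt 3 : ℂ) with hs
  set β : ℂ → ℂ := fun x => 2 / (3 * s) * cotCoeff x with hβd
  have hβ : AnalyticAt ℂ β 0 := analyticAt_const.mul hcot
  have hβ0 : β 0 = 1 / 6 := by
    simp only [β, cotCoeff, if_pos]
    rw [← hs]
    field_simp
    norm_num
  have h6β : AnalyticAt ℂ (fun x => 6 * β x) 0 := analyticAt_const.mul hβ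
  -- For `α = x` the first flatness equation reads `xG = 6β - 1`. As `6β(0) = 1`, the difference
  -- quotient of `6β` at `0` is a holomorphic solution.
  set G : ℂ → ℂ := dslope (fun x => 6 * β x) 0 with hGd
  have hG : AnalyticAt ℂ G 0 := by
    obtain ⟨p, hp⟩ := h6β
    exact hp.has_fpower_series_dslope_fslope.analyticAt
  have hxG : ∀ x, x * G x = 6 * β x - 1 := by
    intro x
    have := sub_smul_dslope (fun x => 6 * β x) 0 x
    simp only [sub_zero, smul_eq_mul, hβ0] at this
    rw [hGd, this]
    norm_num
  have hfreq : ∃ᶠ x in 𝓝[≠] (0 : ℂ), x ∈ Complex.slitPlane := by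
    have ht : Tendsto (fun t : ℝ => (t : ℂ)) (𝓝[>] 0) (𝓝[≠] 0) := by
      refine tendsto_nhdsWithin_iff.2 ⟨?_, ?_⟩
      · have := (Complex.continuous_ofReal.tendsto 0).mono_left (nhdsWithin_le_nhds (s := Set.Ioi 0))
        simpa using this
      · filter_upwards [self_mem_nhdsWithin] with t ht
        simpa using (ne_of_gt ht)
    refine ht.frequently (Eventually.frequently ?_)
    filter_upwards [self_mem_nhdsWithin] with t ht
    exact Complex.ofReal_mem_slitPlane.2 ht
  have hode : ∀ᶠ x in 𝓝 (0 : ℂ), deriv β x = -(3 / 2) * G x * β x - 4 / 3 * x ^ 2 := by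
    -- Both sides are holomorphic at `0`, so by the identity theorem it suffices to compare them at
    -- points of the slit plane accumulating at `0`.
    refine (hβ.deriv.frequently_eq_iff_eventually_eq (((analyticAt_const.mul hG).mul hβ).sub
      (analyticAt_const.mul (analyticAt_id.pow 2)))).1 ?_
    refine (hfreq.and_eventually hsin).mono fun x ⟨h1, h2⟩ => ?_
    have hx0 : x ≠ 0 := Complex.slitPlane_ne_zero h1
    rw [((hasDerivAt_cotCoeff h1 h2).const_mul (2 / (3 * s))).deriv, ← hs]
    refine mul_left_cancel₀ hx0 ?_
    have e : x * (-(3 / 2) * G x * β x - 4 / 3 * x ^ 2) =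
        -(3 / 2) * (6 * β x - 1) * β x - 4 / 3 * x ^ 3 := by
      rw [← hxG]; ring
    refine Eq.trans ?_ e.symm
    simp only [β]
    field_simp
    rw [hs2]
    ring
  refine exists_family_of_flat (α := fun x => x) (β := β) (G := G) analyticAt_id hβ hG
    (Eventually.of_forall fun x => (hasDerivAt_id' x).congr_deriv (by rw [hxG]; ring)) ?_ ?_ ?_
  · filter_upwards [hode, hβ.eventually_analyticAt] with x h1 h2
    rw [← h1]
    exact h2.differentiableAt.hasDerivAt
  · rw [hβ0]; norm_num
  · simp only [webForm5, sqrt_twentySeven, ← hs, β]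
    congr 1
    funext q
    ring

end FrobWeb

theorem mainTheorem6 (W : FrobWeb.CubicForm)
    (hW : W = FrobWeb.webForm5 ∨ ∃ L : ℂ, Complex.cos L ≠ 0 ∧ W = FrobWeb.webForm6 L) :
    ∃ (T : Set ℂ) (F : ℂ → FrobWeb.FrobeniusGerm),
      IsOpen T ∧ IsConnected T ∧
      FrobWeb.FrobeniusGerm.IsHolomorphicFamily T F ∧
      (∀ τ ∈ T, (F τ).IsMassive ∧ (F τ).HasNullUnit ∧
        ∀ ψ : FrobWeb.C2 → FrobWeb.C3, FrobWeb.IsTransverseSurface (F τ) ψ →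
          ∃ K : FrobWeb.CubicForm, FrobWeb.IsBookletWeb (F τ) ψ K ∧
            FrobWeb.WebDiffeomorphic K W) ∧
      (∀ τ ∈ T, ∀ σ ∈ T, τ ≠ σ → ¬ (F τ).Equivalent (F σ)) := by
  rcases hW with rfl | ⟨L, hL, rfl⟩
  · exact FrobWeb.exists_family_webForm5
  · exact FrobWeb.exists_family_webForm6 hL
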